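/- Let $\mathscr H_1=\ell^2(\mathbb Z)\otimes\mathbb C^2$ with standard basis $\delta_n^{\pm}=\delta_n\otimes e_\pm$ ($n\in\mathbb Z$, $e_+=[1,0]^\top$, $e_-=[0,1]^\top$), and write $\lambda'=\sqrt{1-\lambda^2}$ for $\lambda\in[0,1]$. For $\lambda_1,\lambda_2\in[0,1]$ and $\Phi,\theta\in\mathbb R$ let $$W_{\lambda_1,\lambda_2,\Phi,\theta}=S_{\lambda_1}Q_{\lambda_2,\Phi,\theta}:\mathscr H_1\to\mathscr H_1,$$ where $S_\lambda\delta_n^\pm=\lambda\,\delta_{n\pm1}^\pm\pm\lambda'\,\delta_n^\mp$, and $[Q_{\lambda_2,\Phi,\theta}\psi]_n=Q_n\psi_n$ with $$Q_n=\begin{bmatrix}\lambda_2\cos(2\pi(n\Phi+\theta))+i\lambda_2' & -\lambda_2\sin(2\pi(n\Phi+\theta))\\ \lambda_2\sin(2\pi(n\Phi+\theta)) & \lambda_2\cos(2\pi(n\Phi+\theta))-i\lambda_2'\end{bmatrix}.$$ **Proposition.** Let $\Phi$ be irrational and let $0\le\lambda_2<\lambda_1\le1$. Then for every $\theta\in\mathbb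 R$ the point spectrum (the set of eigenvalues) of $W_{\lambda_1,\lambda_2,\Phi,\theta}$ is empty. -/

import Mathlib

open scoped Matrix

/-- The Hilbert space `ℓ²(ℤ) ⊗ ℂ² ≅ ℓ²(ℤ, ℂ²)`.  The coordinates of `ψ` are `ψ n 0 = ψₙ⁺` and
`ψ n 1 = ψₙ⁻`. -/
abbrev WalkSpace : Type := lp (fun _ : ℤ => EuclideanSpace ℂ (Fin 2)) 2

theorem summable_shift (a : ℤ → ℝ) (ha : Summable a) (k : ℤ) :
    Summable (fun n => a (n + k)) ∧ ∑' n, a (n + k) = ∑' n, a n :=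
  ⟨(Equiv.addRight k).summable_iff.mpr ha, (Equiv.addRight k).tsum_eq a⟩

/-- A finite-difference operator on `ℂ²`-valued sequences which only involves nearest neighbours
and has uniformly bounded coefficients maps `ℓ²(ℤ, ℂ²)` into itself. -/
theorem memℓp_of_nearest_neighbour
    (L : (ℤ → EuclideanSpace ℂ (Fin 2)) →ₗ[ℂ] (ℤ → EuclideanSpace ℂ (Fin 2)))
    (C : ℝ) (hC : ∀ ψ n, ‖L ψ n‖ ≤ C * (‖ψ (n - 1)‖ + ‖ψ n‖ + ‖ψ (n + 1)‖))
    (ψ : WalkSpace) :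
    Memℓp (L ψ) 2 ∧ ∑' n, ‖L ψ n‖ ^ 2 ≤ 9 * C ^ 2 * ‖ψ‖ ^ 2 := by
  have hs0 : Summable fun n => ‖ψ n‖ ^ 2 := by
    have := (lp.memℓp ψ).summable (by norm_num)
    simpa using this
  have hn : ‖ψ‖ ^ 2 = ∑' n, ‖ψ n‖ ^ 2 := by
    have := lp.norm_rpow_eq_tsum (p := 2) (by norm_num) ψ
    simpa using this
  obtain ⟨hs1, e1⟩ := summable_shift _ hs0 (-1)
  obtain ⟨hs2, e2⟩ := summable_shift _ hs0 1
  simp only [← sub_eq_add_neg] at hs1 e1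
  have hb : ∀ n, ‖L ψ n‖ ^ 2 ≤
      3 * C ^ 2 * (‖ψ (n - 1)‖ ^ 2 + ‖ψ n‖ ^ 2 + ‖ψ (n + 1)‖ ^ 2) := by
    intro n
    have h1 := pow_le_pow_left₀ (norm_nonneg _) (hC ψ n) 2
    refine h1.trans ?_
    rw [mul_pow, mul_comm (3 : ℝ), mul_assoc]
    refine mul_le_mul_of_nonneg_left ?_ (sq_nonneg C)
    nlinarith [sq_nonneg (‖ψ (n - 1)‖ - ‖ψ n‖), sq_nonneg (‖ψ (n - 1)‖ - ‖ψ (n + 1)‖),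
      sq_nonneg (‖ψ n‖ - ‖ψ (n + 1)‖)]
  have hs : Summable fun n => 3 * C ^ 2 * (‖ψ (n - 1)‖ ^ 2 + ‖ψ n‖ ^ 2 + ‖ψ (n + 1)‖ ^ 2) :=
    ((hs1.add hs0).add hs2).mul_left _
  have hsL : Summable fun n => ‖L ψ n‖ ^ 2 :=
    Summable.of_nonneg_of_le (fun n => sq_nonneg _) hb hs
  refine ⟨memℓp_gen (by simpa using hsL), (hsL.tsum_le_tsum hb hs).trans (le_of_eq ?_)⟩
  rw [tsum_mul_left, (hs1.add hs0).tsum_add hs2, hs1.tsum_add hs0, e1, e2, hn]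
  ring

/-- The bounded operator on `ℓ²(ℤ, ℂ²)` given by a nearest-neighbour finite-difference operator
with uniformly bounded coefficients: `(boundedOf L h ψ) n = L ψ n`. -/
noncomputable def boundedOf
    (L : (ℤ → EuclideanSpace ℂ (Fin 2)) →ₗ[ℂ] (ℤ → EuclideanSpace ℂ (Fin 2)))
    (h : ∃ C : ℝ, ∀ ψ n, ‖L ψ n‖ ≤ C * (‖ψ (n - 1)‖ + ‖ψ n‖ + ‖ψ (n + 1)‖)) :
    WalkSpace →L[ℂ] WalkSpace :=
  LinearMap.mkContinuousOfExistsBound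
    { toFun := fun ψ => ⟨L ψ, (memℓp_of_nearest_neighbour L h.choose h.choose_spec ψ).1⟩
      map_add' := fun ψ φ => Subtype.ext (L.map_add ψ φ)
      map_smul' := fun c ψ => Subtype.ext (L.map_smul c ψ) }
    (by
      refine ⟨3 * |h.choose|, fun ψ => ?_⟩
      have h2 := (memℓp_of_nearest_neighbour L h.choose h.choose_spec ψ).2
      refine (sq_le_sq₀ (norm_nonneg _) (by positivity)).mp ?_
      have h3 := lp.norm_rpow_eq_tsum (p := 2) (by norm_num)
        (⟨L ψ, (memℓp_of_nearest_neighbour L h.choose h.choose_spec ψ).1⟩ : WalkSpace)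
      simp only [ENNReal.toReal_ofNat, Real.rpow_ofNat] at h3
      refine (le_of_eq h3).trans (h2.trans (le_of_eq ?_))
      rw [mul_pow, mul_pow, sq_abs]
      norm_num)

theorem boundedOf_apply
    (L : (ℤ → EuclideanSpace ℂ (Fin 2)) →ₗ[ℂ] (ℤ → EuclideanSpace ℂ (Fin 2)))
    (h : ∃ C : ℝ, ∀ ψ n, ‖L ψ n‖ ≤ C * (‖ψ (n - 1)‖ + ‖ψ n‖ + ‖ψ (n + 1)‖))
    (ψ : WalkSpace) (n : ℤ) : boundedOf L h ψ n = L ψ n := rfl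

/-- The complementary coupling `λ' = √(1 - λ²)`. -/
noncomputable def coCoupling (lam : ℝ) : ℝ := Real.sqrt (1 - lam ^ 2)

/-- The split-step shift as a finite-difference operator on all `ℂ²`-valued sequences:
`[Sψ]ₙ⁺ = λ ψₙ₋₁⁺ - λ' ψₙ⁻` and `[Sψ]ₙ⁻ = λ ψₙ₊₁⁻ + λ' ψₙ⁺`. -/
noncomputable def shiftFormal (lam : ℝ) :
    (ℤ → EuclideanSpace ℂ (Fin 2)) →ₗ[ℂ] (ℤ → EuclideanSpace ℂ (Fin 2)) where
  toFun ψ n := !₂[(lam : ℂ) * ψ (n - 1) 0 - (coCoupling lam : ℂ) * ψ n 1,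
    (lam : ℂ) * ψ (n + 1) 1 + (coCoupling lam : ℂ) * ψ n 0]
  map_add' ψ φ := by
    funext n; ext i; fin_cases i <;> simp <;> ring
  map_smul' c ψ := by
    funext n; ext i; fin_cases i <;> simp <;> ring

theorem norm_le_coords (v : EuclideanSpace ℂ (Fin 2)) : ‖v‖ ≤ ‖v 0‖ + ‖v 1‖ := by
  rw [EuclideanSpace.norm_eq, Fin.sum_univ_two]
  refine Real.sqrt_le_iff.mpr ⟨by positivity, ?_⟩
  nlinarith [norm_nonneg (v 0), norm_nonneg (v 1), mul_nonneg (norm_nonneg (v 0)) (norm_nonneg (v 1))]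

theorem shiftFormal_bound (lam : ℝ) : ∃ C : ℝ, ∀ ψ n,
    ‖shiftFormal lam ψ n‖ ≤ C * (‖ψ (n - 1)‖ + ‖ψ n‖ + ‖ψ (n + 1)‖) := by
  refine ⟨|lam| + 2 * |coCoupling lam|, fun ψ n => (norm_le_coords _).trans ?_⟩
  have h0 : ‖shiftFormal lam ψ n 0‖ ≤ |lam| * ‖ψ (n - 1)‖ + |coCoupling lam| * ‖ψ n‖ := by
    refine (norm_sub_le _ _).trans ?_
    rw [norm_mul, norm_mul, Complex.norm_real, Complex.norm_real, Real.norm_eq_abs,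
      Real.norm_eq_abs]
    gcongr <;> exact PiLp.norm_apply_le _ _
  have h1 : ‖shiftFormal lam ψ n 1‖ ≤ |lam| * ‖ψ (n + 1)‖ + |coCoupling lam| * ‖ψ n‖ := by
    refine (norm_add_le _ _).trans ?_
    rw [norm_mul, norm_mul, Complex.norm_real, Complex.norm_real, Real.norm_eq_abs,
      Real.norm_eq_abs]
    gcongr <;> exact PiLp.norm_apply_le _ _
  have a := mul_nonneg (abs_nonneg lam) (norm_nonneg (ψ n))
  have b := mul_nonneg (abs_nonneg (coCoupling lam)) (norm_nonneg (ψ (n - 1)))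
  have c := mul_nonneg (abs_nonneg (coCoupling lam)) (norm_nonneg (ψ (n + 1)))
  nlinarith

/-- The split-step shift `S_λ` on `ℓ²(ℤ, ℂ²)`. -/
noncomputable def splitStepShift (lam : ℝ) : WalkSpace →L[ℂ] WalkSpace :=
  boundedOf (shiftFormal lam) (shiftFormal_bound lam)

/-- The action of `S_λ` on the standard basis:
`S_λ δₙ⁺ = λ δₙ₊₁⁺ + λ' δₙ⁻` and `S_λ δₙ⁻ = λ δₙ₋₁⁻ - λ' δₙ⁺`. -/
theorem splitStepShift_single (lam : ℝ) (n : ℤ) :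
    splitStepShift lam (lp.single 2 n (EuclideanSpace.single 0 1)) =
        (lam : ℂ) • lp.single 2 (n + 1) (EuclideanSpace.single 0 1)
          + (coCoupling lam : ℂ) • lp.single 2 n (EuclideanSpace.single 1 1) ∧
      splitStepShift lam (lp.single 2 n (EuclideanSpace.single 1 1)) =
        (lam : ℂ) • lp.single 2 (n - 1) (EuclideanSpace.single 1 1)
          - (coCoupling lam : ℂ) • lp.single 2 n (EuclideanSpace.single 0 1) := by
  constructor
  · ext m i
    change shiftFormal lam (Pi.single n (EuclideanSpace.single 0 1)) m i =
      (lam : ℂ) * (Pi.single (n + 1) (EuclideanSpace.single 0 1) : ℤ → EuclideanSpace ℂ (Fin 2)) m i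
      + (coCoupling lam : ℂ) *
        (Pi.single n (EuclideanSpace.single 1 1) : ℤ → EuclideanSpace ℂ (Fin 2)) m i
    have hm : (m = n + 1) = (m - 1 = n) := propext (by omega)
    simp only [shiftFormal, LinearMap.coe_mk, AddHom.coe_mk, Pi.single_apply, hm]
    by_cases h1 : m = n <;> by_cases h2 : m - 1 = n <;> by_cases h3 : m + 1 = n <;>
      fin_cases i <;> simp [h1, h2, h3]
  · ext m i
    change shiftFormal lam (Pi.single n (EuclideanSpace.single 1 1)) m i =
      (lam : ℂ) * (Pi.single (n - 1) (EuclideanSpace.single 1 1) : ℤ → EuclideanSpace ℂ (Fin 2)) m i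
      - (coCoupling lam : ℂ) *
        (Pi.single n (EuclideanSpace.single 0 1) : ℤ → EuclideanSpace ℂ (Fin 2)) m i
    have hm : (m = n - 1) = (m + 1 = n) := propext (by omega)
    simp only [shiftFormal, LinearMap.coe_mk, AddHom.coe_mk, Pi.single_apply, hm]
    by_cases h1 : m = n <;> by_cases h2 : m - 1 = n <;> by_cases h3 : m + 1 = n <;>
      fin_cases i <;> simp [h1, h2, h3]

/-- The local coin `Q_{λ,Φ,θ,n}`. -/
noncomputable def coin (lam Φ θ : ℝ) (n : ℤ) : Matrix (Fin 2) (Fin 2) ℂ :=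
  !![((lam * Real.cos (2 * Real.pi * (n * Φ + θ)) : ℝ) : ℂ) + Complex.I * (coCoupling lam : ℂ),
      ((-(lam * Real.sin (2 * Real.pi * (n * Φ + θ))) : ℝ) : ℂ);
    ((lam * Real.sin (2 * Real.pi * (n * Φ + θ)) : ℝ) : ℂ),
      ((lam * Real.cos (2 * Real.pi * (n * Φ + θ)) : ℝ) : ℂ) - Complex.I * (coCoupling lam : ℂ)]

/-- The coin operator on all `ℂ²`-valued sequences, `[Qψ]ₙ = Qₙ ψₙ`. -/
noncomputable def coinFormal (lam Φ θ : ℝ) :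
    (ℤ → EuclideanSpace ℂ (Fin 2)) →ₗ[ℂ] (ℤ → EuclideanSpace ℂ (Fin 2)) where
  toFun ψ n := Matrix.toEuclideanLin (coin lam Φ θ n) (ψ n)
  map_add' ψ φ := by funext n; simp
  map_smul' c ψ := by funext n; simp

theorem coinFormal_bound (lam Φ θ : ℝ) : ∃ C : ℝ, ∀ ψ n,
    ‖coinFormal lam Φ θ ψ n‖ ≤ C * (‖ψ (n - 1)‖ + ‖ψ n‖ + ‖ψ (n + 1)‖) := by
  refine ⟨4 * (|lam| + |coCoupling lam|), fun ψ n => (norm_le_coords _).trans ?_⟩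
  have hc : ∀ i j, ‖coin lam Φ θ n i j‖ ≤ |lam| + |coCoupling lam| := by
    have hcos : ‖((lam * Real.cos (2 * Real.pi * (n * Φ + θ)) : ℝ) : ℂ)‖ ≤ |lam| := by
      rw [Complex.norm_real, Real.norm_eq_abs, abs_mul]
      exact mul_le_of_le_one_right (abs_nonneg _) (Real.abs_cos_le_one _)
    have hsin : |lam * Real.sin (2 * Real.pi * (n * Φ + θ))| ≤ |lam| := by
      rw [abs_mul]
      exact mul_le_of_le_one_right (abs_nonneg _) (Real.abs_sin_le_one _)
    have hI : ‖Complex.I * (coCoupling lam : ℂ)‖ = |coCoupling lam| := by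
      rw [norm_mul, Complex.norm_I, one_mul, Complex.norm_real, Real.norm_eq_abs]
    have hp := abs_nonneg (coCoupling lam)
    intro i j
    fin_cases i <;> fin_cases j
    · exact (norm_add_le _ _).trans (add_le_add hcos hI.le)
    · change ‖((-(lam * Real.sin (2 * Real.pi * (n * Φ + θ))) : ℝ) : ℂ)‖ ≤ _
      rw [Complex.norm_real, Real.norm_eq_abs, abs_neg]
      linarith
    · change ‖((lam * Real.sin (2 * Real.pi * (n * Φ + θ)) : ℝ) : ℂ)‖ ≤ _
      rw [Complex.norm_real, Real.norm_eq_abs]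
      linarith
    · exact (norm_sub_le _ _).trans (add_le_add hcos hI.le)
  have hrow : ∀ i, ‖coinFormal lam Φ θ ψ n i‖ ≤ 2 * (|lam| + |coCoupling lam|) * ‖ψ n‖ := by
    intro i
    have e : coinFormal lam Φ θ ψ n i
        = coin lam Φ θ n i 0 * ψ n 0 + coin lam Φ θ n i 1 * ψ n 1 := by
      simp [coinFormal, Matrix.mulVec, dotProduct, Fin.sum_univ_two]
    rw [e]
    refine (norm_add_le _ _).trans ?_
    rw [norm_mul, norm_mul]
    have k0 := mul_le_mul (hc i 0) (PiLp.norm_apply_le (ψ n) 0) (norm_nonneg _) (by positivity)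
    have k1 := mul_le_mul (hc i 1) (PiLp.norm_apply_le (ψ n) 1) (norm_nonneg _) (by positivity)
    linarith
  have hk : 0 ≤ |lam| + |coCoupling lam| := by positivity
  have a := mul_nonneg hk (norm_nonneg (ψ (n - 1)))
  have b := mul_nonneg hk (norm_nonneg (ψ (n + 1)))
  linarith [hrow 0, hrow 1]

/-- The coin operator `Q_{λ,Φ,θ}` on `ℓ²(ℤ, ℂ²)`. -/
noncomputable def coinOperator (lam Φ θ : ℝ) : WalkSpace →L[ℂ] WalkSpace :=
  boundedOf (coinFormal lam Φ θ) (coinFormal_bound lam Φ θ)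

/-- The unitary almost-Mathieu operator `W_{λ₁,λ₂,Φ,θ} = S_{λ₁} Q_{λ₂,Φ,θ}`. -/
noncomputable def uamo (lam₁ lam₂ Φ θ : ℝ) : WalkSpace →L[ℂ] WalkSpace :=
  (splitStepShift lam₁).comp (coinOperator lam₂ Φ θ)

/-- The point spectrum of a bounded operator: the set of its eigenvalues. -/
def pointSpectrum (T : WalkSpace →L[ℂ] WalkSpace) : Set ℂ :=
  {z | Module.End.HasEigenvalue (T : WalkSpace →ₗ[ℂ] WalkSpace) z}

/-! Aubry duality turns an eigenvector into an invariant section of a cocycle, which forces a zero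
Lyapunov exponent; Jensen's inequality makes that exponent positive when `lam₂ < lam₁`.

In chiral coordinates the coin rotation is diagonal, so a Fourier transform turns its phases into
translations by `2πΦ` and the shifts into multiplications by `w^{±1}`, `w = e^{ix}`. Let `a`, `b` be
the transforms and `τ` a constant phase. Then `v(x) = (a(x), τ⁻¹ b(x - 2πΦ))` satisfies `τ G(w) v(x
+ 2πΦ) = N(w) v(x)`, where `N` is a matrix of polynomials of degree at most 2 and `|det N| = |G|²`
on the circle (`exists_dual_equations`, `norm_quadratic_conj`).

Upper bound (`exists_integrable_log_norm_bound`): ergodicity makes `v` nonzero almost everywhere. In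
a frame containing `v`, the normalised cocycle `N/G` is triangular with unimodular diagonal, up to
the size of `v`. As `log ‖v‖` has integrable increments, every orbit of `N` grows in the mean at
most like `exp(n ∫ log |G|)`, up to `exp(o(n))`.

Lower bound: an orbit of `N` started at an eigenvector of its leading coefficient, with eigenvalue
`ρ`, is polynomial in `w` with top coefficient of size `|ρ|^n`. By Jensen its mean logarithm is at
least `n log |ρ| + O(1)`.

Hence `|ρ|` is at most the Mahler measure of `G` (`log_norm_eigenvalue_le_logMahlerMeasure`). Here
this reads `|z| λ₁ (1 + λ₂') / 2 ≤ |z| λ₂ (1 + λ₁') / 2`, which is false for `λ₂ < λ₁`. -/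

/-! ### Growth of planar linear recursions that possess a nonvanishing solution. -/

/-- The determinant of two vectors of `ℂ²`. -/
def wedge (x y : ℂ × ℂ) : ℂ := x.1 * y.2 - x.2 * y.1

theorem norm_wedge_le (x y : ℂ × ℂ) : ‖wedge x y‖ ≤ 2 * ‖x‖ * ‖y‖ := by
  have h1 := mul_le_mul (norm_fst_le x) (norm_snd_le y) (norm_nonneg _) (norm_nonneg _)
  have h2 := mul_le_mul (norm_snd_le x) (norm_fst_le y) (norm_nonneg _) (norm_nonneg _)
  refine (norm_sub_le _ _).trans ?_
  rw [norm_mul, norm_mul]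
  linarith

/-- Completes `v` to a unimodular frame. Placing `y` on the axis opposite the larger coordinate of
`v` makes its sup norm exactly `‖v‖⁻¹`. -/
theorem exists_wedge_eq_one {v : ℂ × ℂ} (hv : v ≠ 0) :
    ∃ y : ℂ × ℂ, wedge v y = 1 ∧ ‖y‖ = ‖v‖⁻¹ := by
  have hn : ‖v‖ = max ‖v.1‖ ‖v.2‖ := rfl
  have hpos : 0 < ‖v‖ := norm_pos_iff.mpr hv
  rcases le_total ‖v.2‖ ‖v.1‖ with h | h
  · rw [max_eq_left h] at hn
    have h0 : v.1 ≠ 0 := norm_pos_iff.mp (hn ▸ hpos)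
    exact ⟨(0, v.1⁻¹), by simp [wedge, h0], by simp [hn, Prod.norm_def]⟩
  · rw [max_eq_right h] at hn
    have h0 : v.2 ≠ 0 := norm_pos_iff.mp (hn ▸ hpos)
    exact ⟨(-v.2⁻¹, 0), by simp [wedge, h0], by simp [hn, Prod.norm_def]⟩

theorem eq_wedge_smul_add {v y : ℂ × ℂ} (h : wedge v y = 1) (u : ℂ × ℂ) :
    u = wedge u y • v + wedge v u • y := by
  unfold wedge at *
  ext
  · simp only [Prod.fst_add, Prod.smul_fst, smul_eq_mul]
    linear_combination (-u.1) * h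
  · simp only [Prod.snd_add, Prod.smul_snd, smul_eq_mul]
    linear_combination (-u.2) * h

theorem wedge_smul_add_left (c k : ℂ) (x y w : ℂ × ℂ) :
    wedge (c • x + k • y) w = c * wedge x w + k * wedge y w := by
  simp only [wedge, Prod.fst_add, Prod.snd_add, Prod.smul_fst, Prod.smul_snd, smul_eq_mul]
  ring

/-- If `N` carries `v` to `d • v'` and scales determinants by `|d|²`, then `v'` cannot be much
shorter than `|d| v`. -/
theorem norm_mul_le_of_wedge_scaling (N : ℂ × ℂ →ₗ[ℂ] ℂ × ℂ) {v v' : ℂ × ℂ} {d : ℂ} {C : ℝ}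
    (hv : v ≠ 0) (hd : d ≠ 0) (hN : ∀ x, ‖N x‖ ≤ C * ‖x‖) (hvv : d • v' = N v)
    (hdet : ∀ x y, ‖wedge (N x) (N y)‖ = ‖d‖ ^ 2 * ‖wedge x y‖) :
    ‖v‖ * ‖d‖ ≤ 2 * C * ‖v'‖ := by
  obtain ⟨y, hy, hyn⟩ := exists_wedge_eq_one hv
  have h1 := hdet v y
  have h2 : wedge (d • v') (N y) = d * wedge v' (N y) := by
    simp only [wedge, Prod.smul_fst, Prod.smul_snd, smul_eq_mul]; ring
  rw [← hvv, h2, hy, norm_one, mul_one, norm_mul, pow_two] at h1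
  have hdp : 0 < ‖d‖ := norm_pos_iff.mpr hd
  have h3 := mul_left_cancel₀ hdp.ne' h1
  have hvp : 0 < ‖v‖ := norm_pos_iff.mpr hv
  have h4 : ‖d‖ ≤ 2 * ‖v'‖ * (C * ‖v‖⁻¹) := by
    rw [← h3, ← hyn]
    exact (norm_wedge_le _ _).trans (mul_le_mul_of_nonneg_left (hN y) (by positivity))
  calc ‖v‖ * ‖d‖ ≤ ‖v‖ * (2 * ‖v'‖ * (C * ‖v‖⁻¹)) := mul_le_mul_of_nonneg_left h4 hvp.le
    _ = 2 * C * ‖v'‖ := by field_simp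

/-- A solution of a normalised linear recursion in `ℂ²` is controlled by the variation of the
length of another, nowhere vanishing solution. -/
theorem norm_le_of_log_norm_variation (N : ℕ → ℂ × ℂ →ₗ[ℂ] ℂ × ℂ) (d : ℕ → ℂ) (v u : ℕ → ℂ × ℂ)
    {C X Y : ℝ} {n : ℕ} (hC : 0 ≤ C) (hd : ∀ k, d k ≠ 0) (hv : ∀ k, v k ≠ 0)
    (hN : ∀ k x, ‖N k x‖ ≤ C * ‖x‖)
    (hdet : ∀ k x y, ‖wedge (N k x) (N k y)‖ = ‖d k‖ ^ 2 * ‖wedge x y‖)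
    (hvv : ∀ k, d k • v (k + 1) = N k (v k)) (huu : ∀ k, d k • u (k + 1) = N k (u k))
    (hX : ∀ k ≤ n, |Real.log ‖v k‖ - Real.log ‖v 0‖| ≤ X)
    (hY : ∀ k < n, -Real.log ‖d k‖ ≤ Y) (hY0 : 0 ≤ Y) :
    ‖u n‖ ≤ ‖u 0‖ * ((4 + 4 * C * n) * Real.exp (3 * X + Y)) := by
  choose y hy hyn using fun k => exists_wedge_eq_one (hv k)
  have hvp : ∀ k, 0 < ‖v k‖ := fun k => norm_pos_iff.mpr (hv k)
  have hdp : ∀ k, 0 < ‖d k‖ := fun k => norm_pos_iff.mpr (hd k)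
  have hX0 : 0 ≤ X := by simpa using hX 0 (Nat.zero_le _)
  have hup : ∀ k ≤ n, ‖v k‖ ≤ ‖v 0‖ * Real.exp X := by
    intro k hk
    rw [← Real.exp_log (hvp k), ← Real.exp_log (hvp 0), ← Real.exp_add, Real.exp_le_exp]
    linarith [(abs_le.mp (hX k hk)).2]
  have hlo : ∀ k ≤ n, ‖v 0‖ ≤ ‖v k‖ * Real.exp X := by
    intro k hk
    rw [← Real.exp_log (hvp k), ← Real.exp_log (hvp 0), ← Real.exp_add, Real.exp_le_exp]
    linarith [(abs_le.mp (hX k hk)).1]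
  have hdlo : ∀ k < n, 1 ≤ ‖d k‖ * Real.exp Y := by
    intro k hk
    rw [← Real.exp_log (hdp k), ← Real.exp_add, Real.one_le_exp_iff]
    linarith [hY k hk]
  -- The coordinate of `u` along `y` has constant modulus, because `(d k)⁻¹ N k` preserves areas.
  have hw : ∀ k, ‖wedge (v k) (u k)‖ = ‖wedge (v 0) (u 0)‖ := by
    intro k
    induction k with
    | zero => rfl
    | succ k ih =>
      rw [← ih]
      have h := hdet k (v k) (u k)
      rw [← hvv, ← huu] at h
      have h2 : wedge (d k • v (k + 1)) (d k • u (k + 1))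
          = d k ^ 2 * wedge (v (k + 1)) (u (k + 1)) := by
        simp only [wedge, Prod.smul_fst, Prod.smul_snd, smul_eq_mul]; ring
      rw [h2, norm_mul, norm_pow] at h
      exact mul_left_cancel₀ (pow_ne_zero 2 (hdp k).ne') h
  have hκ : ∀ k, ‖wedge (v k) (u k)‖ ≤ 2 * ‖v 0‖ * ‖u 0‖ := fun k => by
    rw [hw]; exact norm_wedge_le _ _
  -- In the frames `(v k, y k)` the map `(d k)⁻¹ N k` is triangular and fixes the `v`-direction with
  -- entry 1. The coordinate along `v` therefore changes only through the off-diagonal entry, so it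
  -- grows linearly. The factor `‖v 0‖` makes it scale invariant.
  have hstep : ∀ k < n, ‖v 0‖ * ‖wedge (u (k + 1)) (y (k + 1))‖ ≤
      ‖v 0‖ * ‖wedge (u k) (y k)‖ + ‖u 0‖ * (4 * C * Real.exp (2 * X + Y)) := by
    intro k hk
    have e1 : d k * wedge (u (k + 1)) (y (k + 1)) =
        d k * wedge (u k) (y k) + wedge (v k) (u k) * wedge (N k (y k)) (y (k + 1)) := by
      have h := congrArg (N k) (eq_wedge_smul_add (hy k) (u k))
      rw [map_add, map_smul, map_smul, ← hvv, ← huu, smul_smul] at h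
      have h2 := congrArg (fun t => wedge t (y (k + 1))) h
      simp only [wedge_smul_add_left, hy] at h2
      have h3 : wedge (d k • u (k + 1)) (y (k + 1)) = d k * wedge (u (k + 1)) (y (k + 1)) := by
        simp only [wedge, Prod.smul_fst, Prod.smul_snd, smul_eq_mul]; ring
      rw [h3] at h2
      rw [h2]; ring
    have e2 : ‖wedge (N k (y k)) (y (k + 1))‖ ≤ 2 * (C * ‖v k‖⁻¹) * ‖v (k + 1)‖⁻¹ := by
      refine (norm_wedge_le _ _).trans ?_
      rw [hyn (k + 1)]
      have := hN k (y k)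
      rw [hyn k] at this
      gcongr
    have e3 : ‖d k‖ * ‖wedge (u (k + 1)) (y (k + 1))‖ ≤ ‖d k‖ * ‖wedge (u k) (y k)‖ +
        (2 * ‖v 0‖ * ‖u 0‖) * (2 * (C * ‖v k‖⁻¹) * ‖v (k + 1)‖⁻¹) := by
      rw [← norm_mul, e1]
      refine (norm_add_le _ _).trans ?_
      rw [norm_mul, norm_mul]
      gcongr
      exact hκ k
    have f1 : ‖v 0‖ * ‖v k‖⁻¹ ≤ Real.exp X := by
      rw [← div_eq_mul_inv, div_le_iff₀ (hvp k), mul_comm]; exact hlo k hk.le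
    have f2 : ‖v 0‖ * ‖v (k + 1)‖⁻¹ ≤ Real.exp X := by
      rw [← div_eq_mul_inv, div_le_iff₀ (hvp _), mul_comm]; exact hlo (k + 1) hk
    have f3 : ‖v 0‖ * ((2 * ‖v 0‖ * ‖u 0‖) * (2 * (C * ‖v k‖⁻¹) * ‖v (k + 1)‖⁻¹)) ≤
        ‖d k‖ * (‖u 0‖ * (4 * C * Real.exp (2 * X + Y))) := by
      calc _ = 4 * C * ‖u 0‖ * ((‖v 0‖ * ‖v k‖⁻¹) * (‖v 0‖ * ‖v (k + 1)‖⁻¹)) * 1 := by ring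
        _ ≤ 4 * C * ‖u 0‖ * (Real.exp X * Real.exp X) * (‖d k‖ * Real.exp Y) := by
          gcongr
          exact hdlo k hk
        _ = _ := by rw [Real.exp_add, two_mul, Real.exp_add]; ring
    refine le_of_mul_le_mul_left ?_ (hdp k)
    have := mul_le_mul_of_nonneg_left e3 (hvp 0).le
    linarith
  have hc : ∀ k ≤ n, ‖v 0‖ * ‖wedge (u k) (y k)‖ ≤
      ‖u 0‖ * (2 + 4 * C * k * Real.exp (2 * X + Y)) := by
    intro k
    induction k with
    | zero =>
      intro _
      have h := norm_wedge_le (u 0) (y 0)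
      rw [hyn] at h
      calc _ ≤ ‖v 0‖ * (2 * ‖u 0‖ * ‖v 0‖⁻¹) := mul_le_mul_of_nonneg_left h (norm_nonneg _)
        _ = 2 * ‖u 0‖ := by have := (hvp 0).ne'; field_simp
        _ = _ := by simp; ring
    | succ k ih =>
      intro hk
      have h1 := ih (by omega)
      have h2 := hstep k hk
      push_cast
      linarith
  -- The exponent `3 * X + Y` collects `2 * X` from the off-diagonal entry, `Y` from dividing by `d
  -- k`, and `X` from the length of `v n`.
  have hE1 : Real.exp X ≤ Real.exp (3 * X + Y) := Real.exp_le_exp.mpr (by linarith)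
  calc ‖u n‖ = ‖wedge (u n) (y n) • v n + wedge (v n) (u n) • y n‖ := by
        rw [← eq_wedge_smul_add (hy n)]
    _ ≤ ‖wedge (u n) (y n)‖ * ‖v n‖ + ‖wedge (v n) (u n)‖ * ‖v n‖⁻¹ := by
        refine (norm_add_le _ _).trans ?_
        rw [norm_smul, norm_smul, hyn]
    _ ≤ ‖wedge (u n) (y n)‖ * (‖v 0‖ * Real.exp X) + (2 * ‖v 0‖ * ‖u 0‖) * ‖v n‖⁻¹ := by
        gcongr
        · exact hup n le_rfl
        · exact hκ n
    _ = ‖v 0‖ * ‖wedge (u n) (y n)‖ * Real.exp X + 2 * ‖u 0‖ * (‖v 0‖ * ‖v n‖⁻¹) := by ring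
    _ ≤ ‖u 0‖ * (2 + 4 * C * n * Real.exp (2 * X + Y)) * Real.exp X
        + 2 * ‖u 0‖ * Real.exp X := by
        refine add_le_add (mul_le_mul_of_nonneg_right (hc n le_rfl) (Real.exp_pos _).le)
          (mul_le_mul_of_nonneg_left ?_ (by positivity))
        · rw [← div_eq_mul_inv, div_le_iff₀ (hvp n), mul_comm]; exact hlo n le_rfl
    _ = ‖u 0‖ * (4 * Real.exp X + 4 * C * n * Real.exp (3 * X + Y)) := by
        rw [show 3 * X + Y = (2 * X + Y) + X by ring, Real.exp_add (2 * X + Y) X]; ring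
    _ ≤ ‖u 0‖ * (4 * Real.exp (3 * X + Y) + 4 * C * n * Real.exp (3 * X + Y)) := by gcongr
    _ = _ := by ring

/-- The unnormalised version of `norm_le_of_log_norm_variation`, on the logarithmic scale. -/
theorem log_norm_le_of_log_norm_variation (N : ℕ → ℂ × ℂ →ₗ[ℂ] ℂ × ℂ) (d : ℕ → ℂ)
    (v u : ℕ → ℂ × ℂ)
    {C X Y : ℝ} {n : ℕ} (hC : 0 ≤ C) (hd : ∀ k, d k ≠ 0) (hv : ∀ k, v k ≠ 0)
    (hN : ∀ k x, ‖N k x‖ ≤ C * ‖x‖)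
    (hdet : ∀ k x y, ‖wedge (N k x) (N k y)‖ = ‖d k‖ ^ 2 * ‖wedge x y‖)
    (hvv : ∀ k, d k • v (k + 1) = N k (v k)) (huu : ∀ k, u (k + 1) = N k (u k))
    (hX : ∀ k ≤ n, |Real.log ‖v k‖ - Real.log ‖v 0‖| ≤ X)
    (hY : ∀ k < n, -Real.log ‖d k‖ ≤ Y) (hY0 : 0 ≤ Y) (hun : u n ≠ 0) :
    Real.log ‖u n‖ ≤ ∑ k ∈ Finset.range n, Real.log ‖d k‖ + Real.log ‖u 0‖
      + Real.log (4 + 4 * C * n) + 3 * X + Y := by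
  have hP : ∀ k, ∏ j ∈ Finset.range k, d j ≠ 0 := fun k => Finset.prod_ne_zero_iff.mpr
    fun j _ => hd j
  have h := norm_le_of_log_norm_variation N d v (fun k => (∏ j ∈ Finset.range k, d j)⁻¹ • u k)
    hC hd hv hN hdet hvv (fun k => by
      rw [map_smul, ← huu, smul_smul, Finset.prod_range_succ, mul_inv,
        mul_comm, mul_assoc, inv_mul_cancel₀ (hd k), mul_one]) hX hY hY0
  simp only [Finset.range_zero, Finset.prod_empty, inv_one, one_smul] at h
  rw [norm_smul, norm_inv, inv_mul_le_iff₀ (norm_pos_iff.mpr (hP n)), norm_prod] at h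
  have hpos : 0 < ‖u n‖ := norm_pos_iff.mpr hun
  have hu0 : ‖u 0‖ ≠ 0 := by
    intro h0
    rw [h0] at h
    linarith [h.trans_eq (by ring : _ = (0 : ℝ))]
  have hCn : 0 < 4 + 4 * C * n := by positivity
  have := Real.log_le_log hpos h
  rw [Real.log_mul (Finset.prod_ne_zero_iff.mpr fun j _ => norm_ne_zero_iff.mpr (hd j))
    (by positivity), Real.log_mul hu0 (by positivity), Real.log_mul hCn.ne' (Real.exp_pos _).ne',
    Real.log_exp, Real.log_prod (fun j _ => norm_ne_zero_iff.mpr (hd j))] at this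
  linarith

/-! ### Truncation of coboundaries. -/

/-- Truncation of a real number to `[-M, M]`. -/
noncomputable def clamp (M t : ℝ) : ℝ := max (-M) (min t M)

theorem abs_clamp_le {M : ℝ} (hM : 0 ≤ M) (t : ℝ) : |clamp M t| ≤ M :=
  abs_le.mpr ⟨le_max_left _ _, max_le (by linarith) (min_le_right _ _)⟩

theorem abs_clamp_sub_clamp_le (M s t : ℝ) : |clamp M s - clamp M t| ≤ |s - t| :=
  (abs_max_sub_max_le_max _ _ _ _).trans (max_le (by simp)
    ((abs_min_sub_min_le_max _ _ _ _).trans (max_le le_rfl (by simp))))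

theorem clamp_of_abs_le {M t : ℝ} (h : |t| ≤ M) : clamp M t = t := by
  rw [clamp, min_eq_left (abs_le.mp h).2, max_eq_right (abs_le.mp h).1]

theorem measurable_clamp (M : ℝ) : Measurable (clamp M) :=
  measurable_const.max (measurable_id.min measurable_const)

/-- Increments of `l` telescope against those of the truncation, which moves by at most `2 * M`.
Since `e ≥ 0`, one sum up to `n` serves every `k ≤ n`. -/
theorem abs_iterate_sub_le {Ω : Type*} {T : Ω → Ω} {l e : Ω → ℝ} {M : ℝ} (hM : 0 ≤ M) (he0 : ∀ x, 0 ≤ e x)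
    (he : ∀ x, |(l (T x) - l x) - (clamp M (l (T x)) - clamp M (l x))| ≤ e x)
    (x : Ω) {k n : ℕ} (hk : k ≤ n) :
    |l (T^[k] x) - l x| ≤ 2 * M + ∑ j ∈ Finset.range n, e (T^[j] x) := by
  have h : ∀ k, |(l (T^[k] x) - l x) - (clamp M (l (T^[k] x)) - clamp M (l x))| ≤
      ∑ j ∈ Finset.range k, e (T^[j] x) := by
    intro k
    induction k with
    | zero => simp
    | succ k ih =>
      rw [Finset.sum_range_succ, Function.iterate_succ_apply']
      have h1 := he (T^[k] x)
      refine le_trans ?_ (add_le_add ih h1)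
      refine le_trans (le_of_eq ?_) (abs_add_le _ _)
      congr 1
      ring
  have h1 := h k
  have h2 : ∑ j ∈ Finset.range k, e (T^[j] x) ≤ ∑ j ∈ Finset.range n, e (T^[j] x) :=
    Finset.sum_le_sum_of_subset_of_nonneg (Finset.range_mono hk) fun _ _ _ => he0 _
  have h3 := abs_clamp_le hM (l (T^[k] x))
  have h4 := abs_clamp_le hM (l x)
  rw [abs_le] at *
  constructor <;> linarith [h1.1, h1.2]

open MeasureTheory Filter Topology

/-! ### Mean growth of cocycles with an invariant section. -/

section Cocycle

variable {Ω : Type*} [MeasurableSpace Ω] {μ : Measure Ω} {T : Ω → Ω}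

theorem integrable_sum_comp_iterate (hT : MeasurePreserving T μ μ) {g : Ω → ℝ}
    (hg : Integrable g μ) (n : ℕ) :
    Integrable (fun x => ∑ k ∈ Finset.range n, g (T^[k] x)) μ ∧
      ∫ x, ∑ k ∈ Finset.range n, g (T^[k] x) ∂μ = n * ∫ x, g x ∂μ := by
  have hk : ∀ k, Integrable (fun x => g (T^[k] x)) μ := fun k =>
    (hT.iterate k).integrable_comp_of_integrable hg
  refine ⟨integrable_finsetSum _ fun k _ => hk k, ?_⟩
  rw [integral_finsetSum _ fun k _ => hk k]
  have : ∀ k, ∫ x, g (T^[k] x) ∂μ = ∫ x, g x ∂μ := fun k => by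
    have h := (hT.iterate k).map_eq
    have h2 := integral_map (hT.iterate k).measurable.aemeasurable (f := g)
      (by rw [h]; exact hg.aestronglyMeasurable)
    rw [h] at h2
    exact h2.symm
  simp [this]

/-- An integrable coboundary is, up to a small error in `L¹`, the coboundary of a bounded
function. -/
theorem exists_clamp_coboundary_error_le (hT : MeasurePreserving T μ μ) {l f g : Ω → ℝ}
    (hl : AEMeasurable l μ) (hg : Integrable g μ) (hf : AEMeasurable f μ)
    (hlf : ∀ᵐ x ∂μ, |l (T x) - l x| ≤ g x) {ε : ℝ} (hε : 0 < ε) (hfi : Integrable f μ) :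
    ∃ M : ℝ, 0 ≤ M ∧ ∃ e : Ω → ℝ, Integrable e μ ∧ ∫ x, e x ∂μ ≤ ε ∧
      (∀ x, 0 ≤ e x) ∧ (∀ x, f x ≤ M + e x) ∧
      ∀ x, |(l (T x) - l x) - (clamp M (l (T x)) - clamp M (l x))| ≤ e x := by
  -- Both terms vanish pointwise once `M` exceeds the values involved, and `2 * g + |f|` dominates
  -- them. The second term later controls how small a single `d` can be, with `f = -log ‖d‖`.
  let F : ℕ → Ω → ℝ := fun M x =>
    |(l (T x) - l x) - (clamp M (l (T x)) - clamp M (l x))| + max (f x - M) 0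
  have hlT : AEMeasurable (fun x => l (T x)) μ := hl.comp_quasiMeasurePreserving
    hT.quasiMeasurePreserving
  have hFm : ∀ M, AEStronglyMeasurable (F M) μ := by
    intro M
    refine AEMeasurable.aestronglyMeasurable ?_
    refine AEMeasurable.add ?_ ((hf.sub_const _).max aemeasurable_const)
    refine ((hlT.sub hl).sub (((measurable_clamp M).comp_aemeasurable hlT).sub
      ((measurable_clamp M).comp_aemeasurable hl))).norm
  have hb : ∀ M : ℕ, ∀ᵐ x ∂μ, ‖F M x‖ ≤ 2 * g x + |f x| := by
    intro M
    filter_upwards [hlf] with x hx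
    have h0 : 0 ≤ F M x := add_nonneg (abs_nonneg _) (le_max_right _ _)
    rw [Real.norm_eq_abs, abs_of_nonneg h0]
    have h1 := abs_clamp_sub_clamp_le M (l (T x)) (l x)
    have h2 := abs_sub (l (T x) - l x) (clamp M (l (T x)) - clamp M (l x))
    have h3 : max (f x - M) 0 ≤ |f x| := max_le (by
      have : (0 : ℝ) ≤ M := Nat.cast_nonneg M
      linarith [le_abs_self (f x)]) (abs_nonneg _)
    change _ + _ ≤ _
    linarith
  have hlim : Tendsto (fun M => ∫ x, F M x ∂μ) atTop (𝓝 (∫ _, 0 ∂μ)) := by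
    refine tendsto_integral_of_dominated_convergence (fun x => 2 * g x + |f x|) hFm
      ((hg.const_mul 2).add hfi.abs) hb ?_
    refine Eventually.of_forall fun x => ?_
    refine tendsto_const_nhds.congr' ?_
    obtain ⟨M0, hM0⟩ := exists_nat_ge (max (max |l (T x)| |l x|) (f x))
    filter_upwards [eventually_ge_atTop M0] with M hM
    have hM' : (M0 : ℝ) ≤ M := Nat.cast_le.mpr hM
    have k1 : |l (T x)| ≤ M := ((le_max_left _ _).trans (le_max_left _ _)).trans (hM0.trans hM')
    have k2 : |l x| ≤ M := ((le_max_right _ _).trans (le_max_left _ _)).trans (hM0.trans hM')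
    have k3 : f x ≤ M := (le_max_right _ _).trans (hM0.trans hM')
    simp only [F]
    rw [clamp_of_abs_le k1, clamp_of_abs_le k2, max_eq_right (by linarith)]
    simp
  rw [integral_zero] at hlim
  obtain ⟨M, hM⟩ := (hlim.eventually (ge_mem_nhds hε)).exists
  refine ⟨M, Nat.cast_nonneg M, F M, ?_, hM, fun x => add_nonneg (abs_nonneg _) (le_max_right _ _),
    fun x => ?_, fun x => le_add_of_nonneg_right (le_max_right _ _)⟩
  · exact ((hg.const_mul 2).add hfi.abs).mono' (hFm M) (hb M)
  · have h1 := le_max_left (f x - M) 0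
    have h2 := abs_nonneg ((l (T x) - l x) - (clamp M (l (T x)) - clamp M (l x)))
    simp only [F]
    linarith

/-- If a cocycle of `2 × 2` matrices has a nowhere vanishing invariant section, then after
normalising determinants its orbits grow subexponentially in the mean. -/
theorem exists_integrable_log_norm_bound [IsProbabilityMeasure μ] (hT : MeasurePreserving T μ μ)
    (N : Ω → ℂ × ℂ →ₗ[ℂ] ℂ × ℂ) (d : Ω → ℂ) (v : Ω → ℂ × ℂ) {C : ℝ} (hC : 0 < C)
    (hvm : AEStronglyMeasurable v μ) (hdi : Integrable (fun x => Real.log ‖d x‖) μ)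
    (hd : ∀ᵐ x ∂μ, d x ≠ 0) (hv : ∀ᵐ x ∂μ, v x ≠ 0) (hN : ∀ x y, ‖N x y‖ ≤ C * ‖y‖)
    (hdet : ∀ x y y', ‖wedge (N x y) (N x y')‖ = ‖d x‖ ^ 2 * ‖wedge y y'‖)
    (hvv : ∀ᵐ x ∂μ, d x • v (T x) = N x (v x)) (r : ℂ × ℂ) {ε : ℝ} (hε : 0 < ε) :
    ∃ K : ℝ, ∀ n : ℕ, ∃ H : Ω → ℝ, Integrable H μ ∧
      ∫ x, H x ∂μ ≤ n * (∫ x, Real.log ‖d x‖ ∂μ + ε) + K ∧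
      ∀ᵐ x ∂μ, ∀ u : ℕ → ℂ × ℂ, u 0 = r → (∀ k, u (k + 1) = N (T^[k] x) (u k)) → u n ≠ 0 →
        Real.log ‖u n‖ ≤ H x := by
  set l : Ω → ℝ := fun x => Real.log ‖v x‖ with hl
  have hlm : AEMeasurable l μ := Real.measurable_log.comp_aemeasurable hvm.norm.aemeasurable
  have hvT : ∀ᵐ x ∂μ, v (T x) ≠ 0 := hT.quasiMeasurePreserving.ae hv
  -- Nothing is known about integrability of `log ‖v‖`, but its increment is integrable: bounded
  -- above by the norm of `N`, below by its determinant.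
  have hlf : ∀ᵐ x ∂μ, |l (T x) - l x| ≤
      |Real.log (2 * C)| + |Real.log C| + |Real.log ‖d x‖| := by
    filter_upwards [hd, hv, hvT, hvv] with x hdx hvx hvTx hvvx
    have p1 := norm_pos_iff.mpr hdx
    have p2 := norm_pos_iff.mpr hvx
    have p3 := norm_pos_iff.mpr hvTx
    have h1 : ‖d x‖ * ‖v (T x)‖ ≤ C * ‖v x‖ := by
      rw [← norm_smul, hvvx]; exact hN x _
    have h2 := norm_mul_le_of_wedge_scaling (N x) hvx hdx (hN x) hvvx (hdet x)
    have h3 := Real.log_le_log (by positivity) h1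
    have h4 := Real.log_le_log (by positivity) h2
    rw [Real.log_mul p1.ne' p3.ne', Real.log_mul hC.ne' p2.ne'] at h3
    rw [Real.log_mul p2.ne' p1.ne', Real.log_mul (by positivity) p3.ne'] at h4
    have a1 := le_abs_self (Real.log (2 * C))
    have a2 := le_abs_self (Real.log C)
    have a3 := neg_abs_le (Real.log ‖d x‖)
    have a4 := abs_nonneg (Real.log (2 * C))
    have a5 := abs_nonneg (Real.log C)
    simp only [hl]
    rw [abs_le]
    constructor <;> linarith
  have hgi : Integrable (fun x => |Real.log (2 * C)| + |Real.log C| + |Real.log ‖d x‖|) μ :=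
    (integrable_const _).add hdi.abs
  -- The error `e` is counted four times, thrice in `3 * X` and once in `Y`, so `ε / 8` costs `ε /
  -- 2`. The other half of `ε` absorbs the logarithm of the linear factor.
  obtain ⟨M, hM, e, hei, heε, he0, hef, hel⟩ := exists_clamp_coboundary_error_le hT hlm hgi
    hdi.neg.aemeasurable hlf (show 0 < ε / 8 by positivity) hdi.neg
  obtain ⟨K₀, hK₀⟩ : ∃ K₀ : ℝ, ∀ n : ℕ, Real.log (4 + 4 * C * n) ≤ n * (ε / 2) + K₀ := by
    -- From `log (δ t) ≤ δ t - 1`; this `δ` gives slope `4 * C * δ = ε / 2`.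
    set δ := ε / (8 * C) with hδ
    have hδp : 0 < δ := by positivity
    refine ⟨4 * δ - 1 - Real.log δ, fun n => ?_⟩
    have hp : 0 < 4 + 4 * C * n := by positivity
    have h := Real.log_le_sub_one_of_pos (mul_pos hδp hp)
    rw [Real.log_mul hδp.ne' hp.ne'] at h
    have : δ * (4 + 4 * C * n) = 4 * δ + n * (ε / 2) := by rw [hδ]; field_simp; ring
    linarith
  -- The term `7 * M` is `3 * (2 * M) + M`, from `3 * X + Y`.
  refine ⟨Real.log ‖r‖ + K₀ + 7 * M, fun n => ?_⟩
  obtain ⟨i1, s1⟩ := integrable_sum_comp_iterate hT hdi n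
  obtain ⟨i2, s2⟩ := integrable_sum_comp_iterate hT hei n
  have i3 : Integrable (fun x => ∑ k ∈ Finset.range n, Real.log ‖d (T^[k] x)‖
    + 4 * ∑ k ∈ Finset.range n, e (T^[k] x)) μ := i1.add (i2.const_mul 4)
  refine ⟨fun x => (∑ k ∈ Finset.range n, Real.log ‖d (T^[k] x)‖
    + 4 * ∑ k ∈ Finset.range n, e (T^[k] x)) + (Real.log ‖r‖ + (n * (ε / 2) + K₀) + 7 * M),
    i3.add (integrable_const _), ?_, ?_⟩
  · rw [integral_add i3 (integrable_const _),
      integral_add i1 (i2.const_mul 4), integral_const_mul, s1, s2, integral_const]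
    have hn : (0 : ℝ) ≤ n := Nat.cast_nonneg n
    have := mul_le_mul_of_nonneg_left heε hn
    simp only [probReal_univ, one_smul]
    linarith
  · have all : ∀ {p : Ω → Prop}, (∀ᵐ x ∂μ, p x) → ∀ᵐ x ∂μ, ∀ k, p (T^[k] x) := fun hp =>
      ae_all_iff.mpr fun k => (hT.iterate k).quasiMeasurePreserving.ae hp
    filter_upwards [all hd, all hv, all hvv] with x hdx hvx hvvx u hu0 hu hun
    have hS : ∀ k, 0 ≤ ∑ j ∈ Finset.range k, e (T^[j] x) := fun k =>
      Finset.sum_nonneg fun _ _ => he0 _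
    have h := log_norm_le_of_log_norm_variation (fun k => N (T^[k] x)) (fun k => d (T^[k] x))
      (fun k => v (T^[k] x)) u (X := 2 * M + ∑ j ∈ Finset.range n, e (T^[j] x))
      (Y := M + ∑ j ∈ Finset.range n, e (T^[j] x)) (n := n) hC.le hdx hvx
      (fun k => hN _) (fun k => hdet _)
      (fun k => by rw [Function.iterate_succ_apply']; exact hvvx k) hu
      (fun k hk => abs_iterate_sub_le hM he0 hel x hk)
      (fun k hk => (hef (T^[k] x)).trans (add_le_add_right
        (Finset.single_le_sum (f := fun j => e (T^[j] x)) (fun _ _ => he0 _)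
          (Finset.mem_range.mpr hk)) _)) (add_nonneg hM (hS n)) hun
    rw [hu0] at h
    linarith [hK₀ n]

end Cocycle

-- Irrational rotation and Mahler measure on the circle.

attribute [local instance] Polynomial.instTwoPiPos

/-- The circle `ℝ / 2πℤ`. -/
abbrev Circ : Type := AddCircle (2 * Real.pi)

/-- The normalised Haar measure of the circle. -/
noncomputable abbrev circMeasure : Measure Circ := AddCircle.haarAddCircle

/-- The standard character of the circle. -/
noncomputable abbrev circChar (x : Circ) : ℂ := fourier 1 x

theorem norm_circChar (x : Circ) : ‖circChar x‖ = 1 := by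
  exact Circle.norm_coe _

theorem circChar_injective : Function.Injective circChar := by
  intro x y h
  simp only [circChar, fourier_one] at h
  exact AddCircle.injective_toCircle (by positivity) (Subtype.ext h)

theorem circChar_add (x y : Circ) : circChar (x + y) = circChar x * circChar y := by
  simp [circChar, AddCircle.toCircle_add]

theorem circChar_ne_zero (x : Circ) : circChar x ≠ 0 := by
  rw [← norm_ne_zero_iff, norm_circChar]; exact one_ne_zero

theorem continuous_circChar : Continuous circChar := (fourier 1).continuous

theorem volume_eq_smul_circMeasure :
    (volume : Measure Circ) = ENNReal.ofReal (2 * Real.pi) • circMeasure :=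
  AddCircle.volume_eq_smul_haarAddCircle

theorem circMeasure_eq_smul_volume :
    circMeasure = (ENNReal.ofReal (2 * Real.pi))⁻¹ • (volume : Measure Circ) := by
  rw [volume_eq_smul_circMeasure, smul_smul, ENNReal.inv_mul_cancel, one_smul]
  · simp [Real.pi_pos]
  · exact ENNReal.ofReal_ne_top

theorem ergodic_circle_rotation {Φ : ℝ} (hΦ : Irrational Φ) :
    Ergodic (fun x : Circ => x + ((2 * Real.pi * Φ : ℝ) : Circ)) circMeasure := by
  rw [circMeasure_eq_smul_volume]
  refine Ergodic.smul_measure (AddCircle.ergodic_add_right.mpr ?_) _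
  rw [addOrderOf_eq_zero_iff']
  intro n hn h
  rw [← AddCircle.coe_nsmul, AddCircle.coe_eq_zero_iff] at h
  obtain ⟨m, hm⟩ := h
  simp only [zsmul_eq_mul, nsmul_eq_mul] at hm
  have hpi : (2 * Real.pi) ≠ 0 := by positivity
  have hn' : (n : ℝ) ≠ 0 := by exact_mod_cast hn.ne'
  refine hΦ ⟨(m : ℚ) / n, ?_⟩
  push_cast
  rw [div_eq_iff hn']
  have : (2 * Real.pi) * (m - Φ * n) = 0 := by linarith
  rcases mul_eq_zero.mp this with h | h
  · exact absurd h hpi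
  · linarith

instance : Nontrivial Circ := by
  refine ⟨⟨((Real.pi : ℝ) : Circ), 0, fun h => ?_⟩⟩
  obtain ⟨n, hn⟩ := (AddCircle.coe_eq_zero_iff _).mp h
  rw [zsmul_eq_mul] at hn
  have h2 : (n : ℝ) * 2 = 1 := mul_right_cancel₀ Real.pi_ne_zero (by linarith)
  have h3 : n * 2 = 1 := by exact_mod_cast h2
  omega

theorem ae_eval_circChar_ne_zero {p : Polynomial ℂ} (hp : p ≠ 0) :
    ∀ᵐ x ∂circMeasure, p.eval (circChar x) ≠ 0 := by
  have hfin : Set.Finite {x : Circ | p.eval (circChar x) = 0} := by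
    refine Set.Finite.of_finite_image (f := circChar) ?_ circChar_injective.injOn
    refine (Polynomial.finite_setOfPred_isRoot hp).subset ?_
    rintro _ ⟨x, hx, rfl⟩
    exact hx
  rw [ae_iff]
  simp only [not_not]
  have : volume {x : Circ | p.eval (circChar x) = 0} = 0 := hfin.measure_zero _
  rw [circMeasure_eq_smul_volume, Measure.smul_apply, this, smul_zero]

theorem integrable_log_norm_eval_circChar (p : Polynomial ℂ) :
    Integrable (fun x => Real.log ‖p.eval (circChar x)‖) circMeasure := by
  rw [circMeasure_eq_smul_volume, integrable_smul_measure
    (ENNReal.inv_ne_zero.mpr ENNReal.ofReal_ne_top) (by simp [Real.pi_pos])]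
  refine ((AddCircle.measurePreserving_mk (2 * Real.pi) 0).integrable_comp
    (Real.measurable_log.comp
      ((p.continuous.comp continuous_circChar).norm.measurable)).aestronglyMeasurable).mp ?_
  have h := p.intervalIntegrable_mahlerMeasure
  rw [intervalIntegrable_iff_integrableOn_Ioc_of_le (by positivity)] at h
  rw [zero_add]
  refine h.congr (Eventually.of_forall fun t => ?_)
  simp [circChar, AddCircle.toCircle, circleMap]

theorem integral_log_norm_eval_circChar (p : Polynomial ℂ) :
    ∫ x, Real.log ‖p.eval (circChar x)‖ ∂circMeasure = p.logMahlerMeasure := by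
  rw [AddCircle.integral_haarAddCircle, Polynomial.logMahlerMeasure_def, Real.circleAverage,
    ← AddCircle.intervalIntegral_preimage (2 * Real.pi) 0]
  simp [circChar, AddCircle.toCircle, circleMap]

/-- Jensen's inequality. The nonzero coefficient forces `n` to be the degree, so it is the leading
one. -/
theorem log_norm_coeff_le_logMahlerMeasure {p : Polynomial ℂ} {n : ℕ} (hp : p.natDegree ≤ n)
    (h : p.coeff n ≠ 0) : Real.log ‖p.coeff n‖ ≤ p.logMahlerMeasure := by
  have hn : p.natDegree = n := le_antisymm hp (Polynomial.le_natDegree_of_ne_zero h)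
  rw [Polynomial.logMahlerMeasure_eq_log_MahlerMeasure]
  refine Real.log_le_log (norm_pos_iff.mpr h) ?_
  have := p.leadingCoeff_le_mahlerMeasure
  rwa [Polynomial.leadingCoeff, hn] at this

/-! ### Polynomial cocycles over a rotation. -/

/-- The orbit of a vector under the cocycle over the rotation `w ↦ ωw` defined by the polynomial
matrix with rows `(A, B)` and `(A', B')`. -/
noncomputable def orbitPoly (A B A' B' : Polynomial ℂ) (ω : ℂ) (r : ℂ × ℂ) :
    ℕ → Polynomial ℂ × Polynomial ℂ
  | 0 => (.C r.1, .C r.2)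
  | k + 1 =>
    let P := orbitPoly A B A' B' ω r k
    (A.comp (.C (ω ^ k) * .X) * P.1 + B.comp (.C (ω ^ k) * .X) * P.2,
      A'.comp (.C (ω ^ k) * .X) * P.1 + B'.comp (.C (ω ^ k) * .X) * P.2)

theorem natDegree_comp_C_mul_X_le {p : Polynomial ℂ} {m : ℕ} (hp : p.natDegree ≤ m) (c : ℂ) :
    (p.comp (.C c * .X)).natDegree ≤ m :=
  Polynomial.natDegree_comp_le.trans
    ((Nat.mul_le_mul hp (Polynomial.natDegree_C_mul_le c .X)).trans (by simp))

theorem natDegree_orbitPoly_le {A B A' B' : Polynomial ℂ} (hA : A.natDegree ≤ 2)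
    (hB : B.natDegree ≤ 2) (hA' : A'.natDegree ≤ 2) (hB' : B'.natDegree ≤ 2) (ω : ℂ)
    (r : ℂ × ℂ) (k : ℕ) :
    (orbitPoly A B A' B' ω r k).1.natDegree ≤ 2 * k ∧
      (orbitPoly A B A' B' ω r k).2.natDegree ≤ 2 * k := by
  induction k with
  | zero => simp [orbitPoly]
  | succ k ih =>
    have key : ∀ {p q : Polynomial ℂ}, p.natDegree ≤ 2 → q.natDegree ≤ 2 * k →
        (p.comp (.C (ω ^ k) * .X) * q).natDegree ≤ 2 * (k + 1) := fun hp hq =>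
      (Polynomial.natDegree_mul_le_of_le (natDegree_comp_C_mul_X_le hp _) hq).trans (by omega)
    exact ⟨Polynomial.natDegree_add_le_of_degree_le (key hA ih.1) (key hB ih.2),
      Polynomial.natDegree_add_le_of_degree_le (key hA' ih.1) (key hB' ih.2)⟩

/-- The substitution `w ↦ ω ^ k * w` multiplies the leading matrix by a unimodular scalar only, so
`r` stays an eigenvector and each step contributes `ρ` up to a phase. -/
theorem coeff_orbitPoly {A B A' B' : Polynomial ℂ} (hA : A.natDegree ≤ 2)
    (hB : B.natDegree ≤ 2) (hA' : A'.natDegree ≤ 2) (hB' : B'.natDegree ≤ 2) {ω ρ : ℂ}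
    (hω : ‖ω‖ = 1) {r : ℂ × ℂ} (h1 : A.coeff 2 * r.1 + B.coeff 2 * r.2 = ρ * r.1)
    (h2 : A'.coeff 2 * r.1 + B'.coeff 2 * r.2 = ρ * r.2) (k : ℕ) :
    ∃ c : ℂ, ‖c‖ = 1 ∧ (orbitPoly A B A' B' ω r k).1.coeff (2 * k) = c * ρ ^ k * r.1 ∧
      (orbitPoly A B A' B' ω r k).2.coeff (2 * k) = c * ρ ^ k * r.2 := by
  induction k with
  | zero => exact ⟨1, by simp [orbitPoly]⟩
  | succ k ih =>
    obtain ⟨c, hc, e1, e2⟩ := ih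
    obtain ⟨d1, d2⟩ := natDegree_orbitPoly_le hA hB hA' hB' ω r k
    have key : ∀ {p q : Polynomial ℂ}, p.natDegree ≤ 2 → q.natDegree ≤ 2 * k →
        (p.comp (.C (ω ^ k) * .X) * q).coeff (2 * (k + 1)) =
          (p.coeff 2 * (ω ^ k) ^ 2) * q.coeff (2 * k) := fun {p q} hp hq => by
      rw [show 2 * (k + 1) = 2 + 2 * k by ring,
        Polynomial.coeff_mul_add_eq_of_natDegree_le (natDegree_comp_C_mul_X_le hp _) hq,
        Polynomial.comp_C_mul_X_coeff]
    refine ⟨c * (ω ^ k) ^ 2, by simp [hc, hω], ?_, ?_⟩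
    · simp only [orbitPoly, Polynomial.coeff_add]
      rw [key hA d1, key hB d2, e1, e2]
      linear_combination (ω ^ k) ^ 2 * c * ρ ^ k * h1
    · simp only [orbitPoly, Polynomial.coeff_add]
      rw [key hA' d1, key hB' d2, e1, e2]
      linear_combination (ω ^ k) ^ 2 * c * ρ ^ k * h2

/-- The linear map of `ℂ²` with the given matrix entries. -/
def linMapOfEntries (a b a' b' : ℂ) : ℂ × ℂ →ₗ[ℂ] ℂ × ℂ where
  toFun y := (a * y.1 + b * y.2, a' * y.1 + b' * y.2)
  map_add' x y := by ext <;> simp <;> ring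
  map_smul' c y := by ext <;> simp <;> ring

theorem wedge_linMapOfEntries (a b a' b' : ℂ) (x y : ℂ × ℂ) :
    wedge (linMapOfEntries a b a' b' x) (linMapOfEntries a b a' b' y) =
      (a * b' - b * a') * wedge x y := by
  simp only [wedge, linMapOfEntries, LinearMap.coe_mk, AddHom.coe_mk]
  ring

theorem norm_linMapOfEntries_le {a b a' b' : ℂ} {K : ℝ} (ha : ‖a‖ ≤ K) (hb : ‖b‖ ≤ K)
    (ha' : ‖a'‖ ≤ K) (hb' : ‖b'‖ ≤ K) (y : ℂ × ℂ) :
    ‖linMapOfEntries a b a' b' y‖ ≤ (2 * K) * ‖y‖ := by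
  have key : ∀ {c c' : ℂ}, ‖c‖ ≤ K → ‖c'‖ ≤ K → ‖c * y.1 + c' * y.2‖ ≤ (2 * K) * ‖y‖ := by
    intro c c' hc hc'
    refine (norm_add_le _ _).trans ?_
    rw [norm_mul, norm_mul]
    have k1 := mul_le_mul hc (norm_fst_le y) (norm_nonneg _) ((norm_nonneg _).trans hc)
    have k2 := mul_le_mul hc' (norm_snd_le y) (norm_nonneg _) ((norm_nonneg _).trans hc)
    linarith
  exact max_le (key ha hb) (key ha' hb')

theorem exists_norm_eval_circChar_le (p : Polynomial ℂ) :
    ∃ K : ℝ, ∀ x, ‖p.eval (circChar x)‖ ≤ K := by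
  obtain ⟨K, hK⟩ := (isCompact_univ (X := Circ)).exists_bound_of_continuousOn
    (p.continuous.comp continuous_circChar).continuousOn
  exact ⟨K, fun x => hK x trivial⟩

/-- If a polynomial cocycle over an irrational rotation has a measurable invariant section, with
multiplier `G` whose square has the modulus of the determinant, then the eigenvalues of its leading
coefficient are bounded by the Mahler measure of `G`. -/
theorem log_norm_eigenvalue_le_logMahlerMeasure {A B A' B' G : Polynomial ℂ} (hA : A.natDegree ≤ 2)
    (hB : B.natDegree ≤ 2) (hA' : A'.natDegree ≤ 2) (hB' : B'.natDegree ≤ 2) (hG : G ≠ 0)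
    {ρ r₁ r₂ : ℂ} (hρ : ρ ≠ 0) (hr : r₁ ≠ 0)
    (h1 : A.coeff 2 * r₁ + B.coeff 2 * r₂ = ρ * r₁)
    (h2 : A'.coeff 2 * r₁ + B'.coeff 2 * r₂ = ρ * r₂)
    {α : Circ} (hα : Ergodic (fun x : Circ => x + α) circMeasure)
    {τ : ℂ} (hτ : ‖τ‖ = 1) {v : Circ → ℂ × ℂ} (hvm : AEStronglyMeasurable v circMeasure)
    (hdet : ∀ x : Circ, ‖A.eval (circChar x) * B'.eval (circChar x)
      - B.eval (circChar x) * A'.eval (circChar x)‖ = ‖G.eval (circChar x)‖ ^ 2)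
    (hvv : ∀ᵐ x ∂circMeasure, (τ * G.eval (circChar x)) • v (x + α) =
      linMapOfEntries (A.eval (circChar x)) (B.eval (circChar x)) (A'.eval (circChar x))
        (B'.eval (circChar x)) (v x))
    (hv : ¬ v =ᵐ[circMeasure] 0) :
    Real.log ‖ρ‖ ≤ G.logMahlerMeasure := by
  set N : Circ → ℂ × ℂ →ₗ[ℂ] ℂ × ℂ := fun x => linMapOfEntries (A.eval (circChar x))
    (B.eval (circChar x)) (A'.eval (circChar x)) (B'.eval (circChar x)) with hN
  set d : Circ → ℂ := fun x => τ * G.eval (circChar x) with hd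
  have hdn : ∀ x, ‖d x‖ = ‖G.eval (circChar x)‖ := fun x => by simp [hd, hτ]
  have hd0 : ∀ᵐ x ∂circMeasure, d x ≠ 0 := by
    filter_upwards [ae_eval_circChar_ne_zero hG] with x hx
    rwa [← norm_ne_zero_iff, hdn, norm_ne_zero_iff]
  -- The zero set of `v` is forward invariant up to a null set, hence null or conull by ergodicity.
  have hv0 : ∀ᵐ x ∂circMeasure, v x ≠ 0 := by
    have hs : NullMeasurableSet {x | v x = 0} circMeasure :=
      hvm.nullMeasurableSet_eq_fun aestronglyMeasurable_zero
    have hle : {x | v x = 0} ≤ᵐ[circMeasure] (fun x : Circ => x + α) ⁻¹' {x | v x = 0} := by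
      filter_upwards [hvv, hd0] with x hx hdx hvx
      have hvx' : v x = 0 := hvx
      rw [hvx', map_zero] at hx
      exact (smul_eq_zero.mp hx).resolve_left hdx
    rcases hα.ae_empty_or_univ_of_ae_le_preimage hs hle with h | h
    · filter_upwards [h] with x hx hvx
      exact (Set.mem_empty_iff_false x).mp (hx.mp hvx)
    · refine absurd ?_ hv
      filter_upwards [h] with x hx
      exact hx.mpr trivial
  obtain ⟨K1, hK1⟩ := exists_norm_eval_circChar_le A
  obtain ⟨K2, hK2⟩ := exists_norm_eval_circChar_le B
  obtain ⟨K3, hK3⟩ := exists_norm_eval_circChar_le A'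
  obtain ⟨K4, hK4⟩ := exists_norm_eval_circChar_le B'
  set K := |K1| + |K2| + |K3| + |K4| + 1 with hK
  have hKp : 0 < 2 * K := by positivity
  have hNb : ∀ x y, ‖N x y‖ ≤ (2 * K) * ‖y‖ := fun x y => norm_linMapOfEntries_le
    ((hK1 x).trans (by linarith [le_abs_self K1, abs_nonneg K2, abs_nonneg K3, abs_nonneg K4]))
    ((hK2 x).trans (by linarith [le_abs_self K2, abs_nonneg K1, abs_nonneg K3, abs_nonneg K4]))
    ((hK3 x).trans (by linarith [le_abs_self K3, abs_nonneg K2, abs_nonneg K1, abs_nonneg K4]))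
    ((hK4 x).trans (by linarith [le_abs_self K4, abs_nonneg K2, abs_nonneg K3, abs_nonneg K1])) y
  have hNdet : ∀ x y y', ‖wedge (N x y) (N x y')‖ = ‖d x‖ ^ 2 * ‖wedge y y'‖ := fun x y y' => by
    rw [hN, wedge_linMapOfEntries, norm_mul, hdet, hdn]
  have hdi : Integrable (fun x => Real.log ‖d x‖) circMeasure := by
    simp only [hdn]; exact integrable_log_norm_eval_circChar G
  have hdG : ∫ x, Real.log ‖d x‖ ∂circMeasure = G.logMahlerMeasure := by
    simp only [hdn]; exact integral_log_norm_eval_circChar G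
  refine le_of_forall_pos_le_add fun ε hε => ?_
  obtain ⟨L, hL⟩ := exists_integrable_log_norm_bound hα.toMeasurePreserving N d v hKp hvm hdi hd0
    hv0 hNb hNdet hvv (r₁, r₂) hε
  rw [hdG] at hL
  -- Jensen bounds the mean logarithm of the first component from below, the invariant section from
  -- above. As `L` does not depend on `n`, letting `n` grow finishes.
  have hn : ∀ n : ℕ, n * (Real.log ‖ρ‖ - (G.logMahlerMeasure + ε)) ≤ L - Real.log ‖r₁‖ := by
    intro n
    obtain ⟨H, hHi, hHle, hH⟩ := hL n
    set P := orbitPoly A B A' B' (circChar α) (r₁, r₂) with hP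
    obtain ⟨c, hc, hc1, -⟩ := coeff_orbitPoly hA hB hA' hB' (norm_circChar α)
      (r := (r₁, r₂)) h1 h2 n
    have hcn : ‖(P n).1.coeff (2 * n)‖ = ‖ρ‖ ^ n * ‖r₁‖ := by
      rw [hP, hc1]; simp [hc]
    have hρn : 0 < ‖ρ‖ := norm_pos_iff.mpr hρ
    have hrn : 0 < ‖r₁‖ := norm_pos_iff.mpr hr
    have hc0 : (P n).1.coeff (2 * n) ≠ 0 := by
      rw [← norm_ne_zero_iff, hcn]; positivity
    have hP0 : (P n).1 ≠ 0 := fun h => hc0 (by simp [h])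
    have hlow := log_norm_coeff_le_logMahlerMeasure
      (natDegree_orbitPoly_le hA hB hA' hB' (circChar α) (r₁, r₂) n).1 hc0
    rw [hcn, Real.log_mul (by positivity) hrn.ne', Real.log_pow] at hlow
    have hupp : (P n).1.logMahlerMeasure ≤ ∫ x, H x ∂circMeasure := by
      rw [← integral_log_norm_eval_circChar]
      refine integral_mono_ae (integrable_log_norm_eval_circChar _) hHi ?_
      filter_upwards [hH, ae_eval_circChar_ne_zero hP0] with x hx hPx
      have hT : ∀ k, circChar ((fun x : Circ => x + α)^[k] x) = circChar α ^ k * circChar x := by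
        intro k
        induction k with
        | zero => simp
        | succ k ih => rw [Function.iterate_succ_apply', circChar_add, ih]; ring
      have h := hx (fun k => ((P k).1.eval (circChar x), (P k).2.eval (circChar x)))
        (by simp [hP, orbitPoly]) (fun k => by
          simp only [hN, linMapOfEntries, LinearMap.coe_mk, AddHom.coe_mk, hT]
          simp [hP, orbitPoly, Polynomial.eval_comp]) (fun h => hPx (congrArg Prod.fst h))
      exact (Real.log_le_log (norm_pos_iff.mpr hPx) (norm_fst_le ((P n).1.eval (circChar x),
        (P n).2.eval (circChar x)))).trans h
    linarith
  by_contra! hlt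
  obtain ⟨n, hn'⟩ := exists_nat_gt ((L - Real.log ‖r₁‖) /
    (Real.log ‖ρ‖ - (G.logMahlerMeasure + ε)))
  rw [div_lt_iff₀ (by linarith)] at hn'
  linarith [hn n]

/-! ### Fourier coefficients of square integrable functions. -/

/-- `f` is a square integrable function on the circle with Fourier coefficients `c`. -/
def HasFourierCoeffs (f : Circ → ℂ) (c : ℤ → ℂ) : Prop :=
  MemLp f 2 circMeasure ∧ ∀ n, fourierCoeff f n = c n

namespace HasFourierCoeffs

variable {f g : Circ → ℂ} {c c' : ℤ → ℂ}

theorem integrable (hf : HasFourierCoeffs f c) : Integrable f circMeasure :=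
  hf.1.integrable one_le_two

theorem add (hf : HasFourierCoeffs f c) (hg : HasFourierCoeffs g c') :
    HasFourierCoeffs (fun x => f x + g x) (fun n => c n + c' n) := by
  refine ⟨hf.1.add hg.1, fun n => ?_⟩
  dsimp only
  rw [← hf.2, ← hg.2]
  exact congrFun (fourierCoeff.add hf.integrable hg.integrable) n

theorem const_mul (hf : HasFourierCoeffs f c) (k : ℂ) :
    HasFourierCoeffs (fun x => k * f x) (fun n => k * c n) := by
  refine ⟨hf.1.const_mul k, fun n => ?_⟩
  dsimp only
  rw [← hf.2]
  exact fourierCoeff.const_mul f k n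

theorem fourier_mul (hf : HasFourierCoeffs f c) (k : ℤ) :
    HasFourierCoeffs (fun x => fourier k x * f x) (fun n => c (n - k)) := by
  refine ⟨hf.1.of_le ((fourier k).continuous.aestronglyMeasurable.mul hf.1.aestronglyMeasurable)
    (Eventually.of_forall fun x => ?_), fun n => ?_⟩
  · rw [norm_mul, fourier_apply, Circle.norm_coe, one_mul]
  · dsimp only
    rw [← hf.2, fourierCoeff, fourierCoeff]
    refine integral_congr_ae (Eventually.of_forall fun x => ?_)
    simp only [smul_eq_mul]
    rw [← mul_assoc, ← fourier_add, show -n + k = -(n - k) by ring]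

theorem comp_add_right (hf : HasFourierCoeffs f c) (α : Circ) :
    HasFourierCoeffs (fun x => f (x + α)) (fun n => fourier n α * c n) := by
  have hmp : MeasurePreserving (fun x : Circ => x + α) circMeasure circMeasure :=
    measurePreserving_add_right _ α
  refine ⟨hf.1.comp_measurePreserving hmp, fun n => ?_⟩
  dsimp only
  rw [← hf.2, fourierCoeff, fourierCoeff]
  have h : ∀ x : Circ, fourier (-n) x • f (x + α) =
      fourier n α * (fourier (-n) (x + α) • f (x + α)) := by
    intro x
    have e : fourier (-n) (x + α) = fourier (-n) x * fourier (-n) α := by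
      simp [fourier_apply, smul_add, AddCircle.toCircle_add]
    have e2 : fourier n α * fourier (-n) α = 1 := by
      rw [← fourier_add]; simp
    rw [smul_eq_mul, smul_eq_mul, e]
    linear_combination (-(fourier (-n) x) * f (x + α)) * e2
  simp_rw [h]
  rw [integral_const_mul, integral_add_right_eq_self (fun x : Circ => fourier (-n) x • f x) α]

theorem ae_eq_zero (hf : HasFourierCoeffs f c) (h : ∀ n, c n = 0) : f =ᵐ[circMeasure] 0 := by
  have h0 : hf.1.toLp f = 0 := by
    refine (fourierBasis (T := 2 * Real.pi)).repr.injective ?_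
    rw [map_zero]
    ext n
    rw [fourierBasis_repr, fourierCoeff_congr_ae hf.1.coeFn_toLp, hf.2, h]
    rfl
  exact (MemLp.toLp_eq_toLp_iff hf.1 MemLp.zero).mp (by rw [h0]; rfl)

theorem eq_zero (hf : HasFourierCoeffs f c) (h : f =ᵐ[circMeasure] 0) (n : ℤ) : c n = 0 := by
  rw [← hf.2, fourierCoeff_congr_ae h]
  simp [fourierCoeff]

end HasFourierCoeffs

theorem exists_hasFourierCoeffs {c : ℤ → ℂ} (hc : Memℓp c 2) : ∃ f, HasFourierCoeffs f c := by
  refine ⟨(fourierBasis (T := 2 * Real.pi)).repr.symm ⟨c, hc⟩, Lp.memLp _, fun n => ?_⟩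
  rw [← fourierBasis_repr, LinearIsometryEquiv.apply_symm_apply]

theorem memℓp_coord (ψ : WalkSpace) (i : Fin 2) : Memℓp (fun n => ψ n i) 2 := by
  have hs := (lp.memℓp ψ).summable (by norm_num)
  refine memℓp_gen (Summable.of_nonneg_of_le (fun n => by positivity) (fun n => ?_) hs)
  gcongr
  exact PiLp.norm_apply_le _ _

/-! ### Chiral coordinates and Aubry duality. -/

/-- The chiral coordinates of a walk state, in which the coin rotation is diagonal. -/
noncomputable def chiral (s : ℂ) (ψ : WalkSpace) (n : ℤ) : ℂ := (ψ n 0 + s * Complex.I * ψ n 1) / 2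

theorem memℓp_chiral (s : ℂ) (ψ : WalkSpace) : Memℓp (chiral s ψ) 2 := by
  have h := ((memℓp_coord ψ 0).add ((memℓp_coord ψ 1).const_smul (s * Complex.I))).const_smul
    (1 / 2 : ℂ)
  convert h using 1
  funext n
  simp [chiral]
  ring

theorem coCoupling_sq {lam : ℝ} (h0 : 0 ≤ lam) (h1 : lam ≤ 1) :
    (lam : ℂ) ^ 2 + (coCoupling lam : ℂ) ^ 2 = 1 := by
  have : lam ^ 2 + coCoupling lam ^ 2 = 1 := by
    rw [coCoupling, Real.sq_sqrt (by nlinarith)]; ring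
  exact_mod_cast this

/-- The phase of the coin at site `n`. -/
noncomputable def coinPhase (Φ θ : ℝ) (n : ℤ) : ℂ :=
  Complex.exp (((2 * Real.pi * (n * Φ + θ) : ℝ) : ℂ) * Complex.I)

/-- The eigenvalue equation in the form `Q ψ = z S⁻¹ ψ`. In chiral coordinates the coin is a
diagonal of opposite phases plus a constant swap. -/
theorem eigen_chiral {lam₁ lam₂ Φ θ : ℝ} (h0 : 0 ≤ lam₁) (h1 : lam₁ ≤ 1) {ψ : WalkSpace} {z : ℂ}
    (hψ : uamo lam₁ lam₂ Φ θ ψ = z • ψ) (n : ℤ) :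
    lam₂ * coinPhase Φ θ n * chiral 1 ψ n + Complex.I * coCoupling lam₂ * chiral (-1) ψ n
      = z / 2 * (lam₁ * (chiral 1 ψ (n + 1) + chiral 1 ψ (n - 1))
        + lam₁ * (chiral (-1) ψ (n + 1) - chiral (-1) ψ (n - 1))
        - 2 * Complex.I * coCoupling lam₁ * chiral 1 ψ n) ∧
    lam₂ * (coinPhase Φ θ n)⁻¹ * chiral (-1) ψ n + Complex.I * coCoupling lam₂ * chiral 1 ψ n
      = z / 2 * (lam₁ * (chiral 1 ψ (n + 1) - chiral 1 ψ (n - 1))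
        + lam₁ * (chiral (-1) ψ (n + 1) + chiral (-1) ψ (n - 1))
        + 2 * Complex.I * coCoupling lam₁ * chiral (-1) ψ n) := by
  set φ : ℤ → EuclideanSpace ℂ (Fin 2) := coinFormal lam₂ Φ θ ψ with hφ
  have hE : ∀ n i, shiftFormal lam₁ φ n i = z * ψ n i := fun n i => by
    have h : uamo lam₁ lam₂ Φ θ ψ n i = (z • ψ) n i := by rw [hψ]
    exact h
  have hE0 : ∀ n, (lam₁ : ℂ) * φ (n - 1) 0 - coCoupling lam₁ * φ n 1 = z * ψ n 0 := fun n => hE n 0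
  have hE1 : ∀ n, (lam₁ : ℂ) * φ (n + 1) 1 + coCoupling lam₁ * φ n 0 = z * ψ n 1 := fun n => hE n 1
  have hsq := coCoupling_sq h0 h1
  -- Inverts the shift, using `λ₁² + λ₁'² = 1`.
  have k0 : φ n 0 = z * (lam₁ * ψ (n + 1) 0 + coCoupling lam₁ * ψ n 1) := by
    have e0 := hE0 (n + 1)
    have e1 := hE1 n
    rw [add_sub_cancel_right] at e0
    linear_combination (lam₁ : ℂ) * e0 + (coCoupling lam₁ : ℂ) * e1 - φ n 0 * hsq
  have k1 : φ n 1 = z * (lam₁ * ψ (n - 1) 1 - coCoupling lam₁ * ψ n 0) := by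
    have e0 := hE0 n
    have e1 := hE1 (n - 1)
    rw [sub_add_cancel] at e1
    linear_combination (lam₁ : ℂ) * e1 - (coCoupling lam₁ : ℂ) * e0 - φ n 1 * hsq
  set ω : ℝ := 2 * Real.pi * (n * Φ + θ) with hω
  have c0 : φ n 0 = (lam₂ * Complex.cos ω + Complex.I * coCoupling lam₂) * ψ n 0
      - lam₂ * Complex.sin ω * ψ n 1 := by
    simp [hφ, coinFormal, coin, Matrix.mulVec, dotProduct, Fin.sum_univ_two, hω]
    ring
  have c1 : φ n 1 = lam₂ * Complex.sin ω * ψ n 0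
      + (lam₂ * Complex.cos ω - Complex.I * coCoupling lam₂) * ψ n 1 := by
    simp [hφ, coinFormal, coin, Matrix.mulVec, dotProduct, Fin.sum_univ_two, hω]
  have hp : coinPhase Φ θ n = Complex.cos ω + Complex.sin ω * Complex.I := by
    rw [coinPhase, Complex.exp_mul_I]
  have hp' : (coinPhase Φ θ n)⁻¹ = Complex.cos ω - Complex.sin ω * Complex.I := by
    rw [coinPhase, ← Complex.exp_neg, ← neg_mul, Complex.exp_mul_I, Complex.cos_neg,
      Complex.sin_neg]
    ring
  rw [hp', hp]
  have d0 := c0.symm.trans k0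
  have d1 := c1.symm.trans k1
  have hI := Complex.I_sq
  simp only [chiral]
  constructor
  · linear_combination (1 / 2 : ℂ) * d0 + (Complex.I / 2) * d1 + (lam₂ * Complex.sin ω + z * coCoupling lam₁) / 2 * ψ n 1 * hI
  · linear_combination (1 / 2 : ℂ) * d0 - (Complex.I / 2) * d1 + (lam₂ * Complex.sin ω + z * coCoupling lam₁) / 2 * ψ n 1 * hI

/-- The translation dual to the frequency `Φ`. -/
noncomputable abbrev dualShift (Φ : ℝ) : Circ := ((2 * Real.pi * Φ : ℝ) : Circ)

theorem coinPhase_eq (Φ θ : ℝ) (n : ℤ) :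
    coinPhase Φ θ n = coinPhase Φ θ 0 * fourier n (dualShift Φ) := by
  have hpi : (Real.pi : ℂ) ≠ 0 := by exact_mod_cast Real.pi_ne_zero
  rw [fourier_coe_apply, coinPhase, coinPhase, ← Complex.exp_add]
  congr 1
  push_cast
  field_simp
  ring

theorem norm_coinPhase (Φ θ : ℝ) (n : ℤ) : ‖coinPhase Φ θ n‖ = 1 :=
  Complex.norm_exp_ofReal_mul_I _

/-- Aubry duality: the Fourier transforms of the chiral coordinates of an eigenvector solve the
dual equations almost everywhere. -/
theorem exists_dual_equations {lam₁ lam₂ Φ θ : ℝ} (h0 : 0 ≤ lam₁) (h1 : lam₁ ≤ 1) {ψ : WalkSpace}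
    {z : ℂ} (hψ : uamo lam₁ lam₂ Φ θ ψ = z • ψ) :
    ∃ a b : Circ → ℂ, HasFourierCoeffs a (chiral 1 ψ) ∧ HasFourierCoeffs b (chiral (-1) ψ) ∧
      ∀ᵐ x ∂circMeasure,
        circChar x * (lam₂ * coinPhase Φ θ 0 * a (x + dualShift Φ)
            + Complex.I * coCoupling lam₂ * b x)
          = z * ((lam₁ * (circChar x ^ 2 + 1) / 2 - Complex.I * coCoupling lam₁ * circChar x) * a x
            - lam₁ / 2 * (circChar x ^ 2 - 1) * b x) ∧
        circChar x * (lam₂ * (coinPhase Φ θ 0)⁻¹ * b (x + -dualShift Φ)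
            + Complex.I * coCoupling lam₂ * a x)
          = z * ((lam₁ * (circChar x ^ 2 + 1) / 2 + Complex.I * coCoupling lam₁ * circChar x) * b x
            - lam₁ / 2 * (circChar x ^ 2 - 1) * a x) := by
  obtain ⟨a, ha⟩ := exists_hasFourierCoeffs (memℓp_chiral 1 ψ)
  obtain ⟨b, hb⟩ := exists_hasFourierCoeffs (memℓp_chiral (-1) ψ)
  refine ⟨a, b, ha, hb, ?_⟩
  -- The two dual equations are one statement with `a` and `b` exchanged, the translation reversed
  -- and `s = ±1`. Multiplying by the character clears the frequency `-1`.
  have key : ∀ {f g fs : Circ → ℂ} {c c' cs : ℤ → ℂ}, HasFourierCoeffs f c →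
      HasFourierCoeffs g c' → HasFourierCoeffs fs cs → ∀ {k m s : ℂ},
      (∀ n, k * cs n + m * c' n = z / 2 * (lam₁ * (c (n + 1) + c (n - 1))
        + lam₁ * (c' (n + 1) - c' (n - 1)) - 2 * s * Complex.I * coCoupling lam₁ * c n)) →
      ∀ᵐ x ∂circMeasure, circChar x * (k * fs x + m * g x) =
        z * ((lam₁ * (circChar x ^ 2 + 1) / 2 - s * Complex.I * coCoupling lam₁ * circChar x) * f x
          - lam₁ / 2 * (circChar x ^ 2 - 1) * g x) := by
    intro f g fs c c' cs hf hg hfs k m s h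
    have hF := ((hfs.const_mul k).add (hg.const_mul m)).add
      (((((hf.fourier_mul (-1)).add (hf.fourier_mul 1)).const_mul (-(z / 2 * lam₁))).add
        (((hg.fourier_mul (-1)).add ((hg.fourier_mul 1).const_mul (-1))).const_mul
          (-(z / 2 * lam₁)))).add (hf.const_mul (z * s * Complex.I * coCoupling lam₁)))
    filter_upwards [hF.ae_eq_zero fun n => by
      rw [sub_neg_eq_add]
      linear_combination h n] with x hx
    simp only [Pi.zero_apply] at hx
    have e : fourier (-1) x * circChar x = 1 := by
      rw [circChar, ← fourier_add]; simp
    change fourier (-1) x * fourier 1 x = 1 at e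
    change fourier 1 x * _ = _
    simp only [circChar]
    linear_combination fourier 1 x * hx + (z / 2 * lam₁ * (f x + g x)) * e
  have k1 := key ha hb (ha.comp_add_right (dualShift Φ)) (k := lam₂ * coinPhase Φ θ 0)
    (m := Complex.I * coCoupling lam₂) (s := 1) fun n => by
      have h := (eigen_chiral h0 h1 hψ n).1
      rw [coinPhase_eq] at h
      linear_combination h
  have k2 := key hb ha (hb.comp_add_right (-dualShift Φ)) (k := lam₂ * (coinPhase Φ θ 0)⁻¹)
    (m := Complex.I * coCoupling lam₂) (s := -1) fun n => by
      have h := (eigen_chiral h0 h1 hψ n).2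
      have e : (fourier n (dualShift Φ))⁻¹ = (fourier n (-dualShift Φ) : ℂ) := by
        simp [fourier_apply, AddCircle.toCircle_neg]
      rw [coinPhase_eq, mul_inv, e] at h
      linear_combination h
  filter_upwards [k1, k2] with x h1 h2
  exact ⟨by linear_combination h1, by linear_combination h2⟩

theorem eq_zero_of_chiral_eq_zero {ψ : WalkSpace} (h1 : ∀ n, chiral 1 ψ n = 0)
    (h2 : ∀ n, chiral (-1) ψ n = 0) : ψ = 0 := by
  ext n i
  have e1 := h1 n
  have e2 := h2 n
  unfold chiral at e1 e2
  have f0 : ψ n 0 = 0 := by linear_combination e1 + e2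
  have f1 : ψ n 1 = 0 := by
    linear_combination (-Complex.I) * (e1 - e2) + ψ n 1 * Complex.I_sq
  fin_cases i
  · exact f0
  · exact f1

/-- In chiral coordinates the coin has determinant `λ₂² + λ₂'² = 1`. This excludes `z = 0`, where
the dual multiplier would vanish. -/
theorem eq_zero_of_uamo_eq_zero {lam₁ lam₂ Φ θ : ℝ} (h0 : 0 ≤ lam₁) (h1 : lam₁ ≤ 1)
    (k0 : 0 ≤ lam₂) (k1 : lam₂ ≤ 1) {ψ : WalkSpace} (hψ : uamo lam₁ lam₂ Φ θ ψ = 0) : ψ = 0 := by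
  have hψ' : uamo lam₁ lam₂ Φ θ ψ = (0 : ℂ) • ψ := by rw [hψ, zero_smul]
  have hsq := coCoupling_sq k0 k1
  have hI := Complex.I_sq
  have hp : ∀ n, coinPhase Φ θ n * (coinPhase Φ θ n)⁻¹ = 1 := fun n =>
    mul_inv_cancel₀ (norm_ne_zero_iff.mp (by rw [norm_coinPhase]; exact one_ne_zero))
  refine eq_zero_of_chiral_eq_zero (fun n => ?_) fun n => ?_ <;>
    obtain ⟨e1, e2⟩ := eigen_chiral h0 h1 hψ' n
  · linear_combination (lam₂ : ℂ) * (coinPhase Φ θ n)⁻¹ * e1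
      - Complex.I * coCoupling lam₂ * e2 - chiral 1 ψ n * hsq
      + (coCoupling lam₂ : ℂ) ^ 2 * chiral 1 ψ n * hI - lam₂ ^ 2 * chiral 1 ψ n * hp n
  · linear_combination (lam₂ : ℂ) * (coinPhase Φ θ n) * e2
      - Complex.I * coCoupling lam₂ * e1 - chiral (-1) ψ n * hsq
      + (coCoupling lam₂ : ℂ) ^ 2 * chiral (-1) ψ n * hI - lam₂ ^ 2 * chiral (-1) ψ n * hp n

/-! ### The explicit dual cocycle and the conclusion. -/

/-- The quadratic polynomial `αX² + βX + γ`. -/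
noncomputable def quadPoly (α β γ : ℂ) : Polynomial ℂ :=
  .C α * .X ^ 2 + .C β * .X + .C γ

theorem eval_quadPoly (α β γ w : ℂ) : (quadPoly α β γ).eval w = α * w ^ 2 + β * w + γ := by
  simp [quadPoly]

theorem natDegree_quadPoly_le (α β γ : ℂ) : (quadPoly α β γ).natDegree ≤ 2 :=
  Polynomial.natDegree_quadratic_le

theorem coeff_two_quadPoly (α β γ : ℂ) : (quadPoly α β γ).coeff 2 = α := by
  simp [quadPoly]

theorem quadPoly_ne_zero {α : ℂ} (hα : α ≠ 0) (β γ : ℂ) : quadPoly α β γ ≠ 0 := fun h =>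
  hα (by rw [← coeff_two_quadPoly α β γ, h, Polynomial.coeff_zero])

/-- The multiplier of the dual cocycle, `λ cos x + iλ'` up to a phase. -/
noncomputable def dualMultiplier (lam : ℝ) : Polynomial ℂ :=
  quadPoly (lam / 2) (Complex.I * coCoupling lam) (lam / 2)

theorem coCoupling_nonneg (lam : ℝ) : 0 ≤ coCoupling lam := Real.sqrt_nonneg _

theorem real_coCoupling_sq {lam : ℝ} (h0 : 0 ≤ lam) (h1 : lam ≤ 1) :
    lam ^ 2 + coCoupling lam ^ 2 = 1 := by
  exact_mod_cast coCoupling_sq h0 h1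

/-- The roots have moduli `(1 - λ') / λ ≤ 1` and `(1 + λ') / λ ≥ 1`, so only the second contributes
beyond the leading coefficient. -/
theorem mahlerMeasure_dualMultiplier {lam : ℝ} (h0 : 0 < lam) (h1 : lam ≤ 1) :
    (dualMultiplier lam).mahlerMeasure = (1 + coCoupling lam) / 2 := by
  have hsq := coCoupling_sq h0.le h1
  have hr := real_coCoupling_sq h0.le h1
  have hc := coCoupling_nonneg lam
  have hl : (lam : ℂ) ≠ 0 := by exact_mod_cast h0.ne'
  have hI := Complex.I_sq
  have hfac : dualMultiplier lam = .C ((2 * lam : ℂ)⁻¹) *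
      ((.C (lam : ℂ) * .X + .C (Complex.I * ((coCoupling lam - 1 : ℝ) : ℂ))) *
        (.C (lam : ℂ) * .X + .C (Complex.I * ((1 + coCoupling lam : ℝ) : ℂ)))) := by
    refine Polynomial.funext fun w => ?_
    simp only [dualMultiplier, eval_quadPoly, Polynomial.eval_mul, Polynomial.eval_add,
      Polynomial.eval_C, Polynomial.eval_X]
    push_cast
    field_simp
    linear_combination hsq - ((coCoupling lam : ℂ) ^ 2 - 1) * hI
  have hc1 : coCoupling lam ≤ 1 := by nlinarith
  rw [hfac, Polynomial.mahlerMeasure_mul, Polynomial.mahlerMeasure_mul,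
    Polynomial.mahlerMeasure_const, Polynomial.mahlerMeasure_C_mul_X_add_C hl,
    Polynomial.mahlerMeasure_C_mul_X_add_C hl, norm_mul, norm_mul, Complex.norm_I, one_mul,
    one_mul, Complex.norm_real, Complex.norm_real, Complex.norm_real, norm_inv, norm_mul,
    Complex.norm_real, Real.norm_eq_abs, Real.norm_eq_abs, Real.norm_eq_abs, abs_of_pos h0,
    abs_of_nonneg (by linarith : 0 ≤ 1 + coCoupling lam),
    abs_of_nonpos (by linarith : coCoupling lam - 1 ≤ 0), max_eq_left (by nlinarith),
    max_eq_right (by linarith)]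
  norm_num
  field_simp

/-- On the unit circle one quadratic is `w ^ 2` times the conjugate of the other. The determinant of
the dual cocycle is a multiple of their product, hence has the modulus of a square. -/
theorem norm_quadratic_conj {w : ℂ} (hw : ‖w‖ = 1) (s t : ℝ) :
    ‖(s : ℂ) * w ^ 2 - Complex.I * t * w + s‖ = ‖(s : ℂ) * w ^ 2 + Complex.I * t * w + s‖ := by
  have h : w * (starRingEnd ℂ) w = 1 := by rw [Complex.mul_conj, Complex.normSq_eq_norm_sq, hw]; simp
  have e : (s : ℂ) * w ^ 2 - Complex.I * t * w + s =
      w ^ 2 * (starRingEnd ℂ) ((s : ℂ) * w ^ 2 + Complex.I * t * w + s) := by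
    simp only [map_add, map_mul, map_pow, Complex.conj_ofReal, Complex.conj_I]
    linear_combination (-(s : ℂ) * (w * (starRingEnd ℂ) w + 1) + Complex.I * t * w) * h
  rw [e, norm_mul, norm_pow, hw, one_pow, one_mul, RCLike.norm_conj]

theorem mainTheorem10 (lam₁ lam₂ Φ : ℝ) (hlam₂ : 0 ≤ lam₂) (hlam : lam₂ < lam₁)
    (hlam₁ : lam₁ ≤ 1) (hΦ : Irrational Φ) :
    ∀ θ : ℝ, pointSpectrum (uamo lam₁ lam₂ Φ θ) = ∅ := by
  intro θ
  rw [Set.eq_empty_iff_forall_notMem]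
  intro z hz
  obtain ⟨ψ, hψ, hψ0⟩ := Module.End.HasEigenvalue.exists_hasEigenvector hz
  have hψz : uamo lam₁ lam₂ Φ θ ψ = z • ψ := Module.End.mem_eigenspace_iff.mp hψ
  have hl1 : 0 < lam₁ := hlam₂.trans_lt hlam
  have hl2 : lam₂ ≤ 1 := hlam.le.trans hlam₁
  have hz0 : z ≠ 0 := by
    rintro rfl
    exact hψ0 (eq_zero_of_uamo_eq_zero hl1.le hlam₁ hlam₂ hl2 (by rw [hψz, zero_smul]))
  obtain ⟨a, b, ha, hb, hab⟩ := exists_dual_equations hl1.le hlam₁ hψz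
  set τ := coinPhase Φ θ 0 with hτ
  have hτn : ‖τ‖ = 1 := norm_coinPhase Φ θ 0
  have hτ0 : τ ≠ 0 := norm_ne_zero_iff.mp (by rw [hτn]; exact one_ne_zero)
  have hnot : ¬ (a =ᵐ[circMeasure] 0 ∧ b =ᵐ[circMeasure] 0) := fun h =>
    hψ0 (eq_zero_of_chiral_eq_zero (ha.eq_zero h.1) (hb.eq_zero h.2))
  set q : ℂ := (coCoupling lam₂ : ℂ) with hq
  have hsq1 := coCoupling_sq hl1.le hlam₁
  have hI := Complex.I_sq
  set A : Polynomial ℂ := quadPoly (-(Complex.I * q * lam₁ * z)) (z ^ 2 + q ^ 2)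
    (Complex.I * q * lam₁ * z) with hA
  set h : Polynomial ℂ := quadPoly (-(Complex.I * z * lam₁ / 2)) q (Complex.I * z * lam₁ / 2)
    with hh
  -- The second dual equation gives `b x` from `a x` and the previous `b`; inserting it in the first
  -- closes the recursion. By `λ₁² + λ₁'² = 1` a common factor `w` cancels, which keeps the degree
  -- at 2.
  have hcell : ∀ᵐ x ∂circMeasure,
      z * lam₂ * (dualMultiplier lam₁).eval (circChar x) * τ * a (x + dualShift Φ) =
        A.eval (circChar x) * a x
          - Complex.I * lam₂ * h.eval (circChar x) * (τ⁻¹ * b (x + -dualShift Φ)) ∧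
      z * (dualMultiplier lam₁).eval (circChar x) * b x =
        Complex.I * h.eval (circChar x) * a x
          + lam₂ * circChar x * (τ⁻¹ * b (x + -dualShift Φ)) := by
    filter_upwards [hab] with x ⟨e1, e2⟩
    have hw := circChar_ne_zero x
    rw [hA, hh, dualMultiplier]
    simp only [eval_quadPoly]
    generalize circChar x = w at *
    have e3 : z * (lam₁ / 2 * w ^ 2 + Complex.I * coCoupling lam₁ * w + lam₁ / 2) * b x =
        Complex.I * (-(Complex.I * z * lam₁ / 2) * w ^ 2 + q * w + Complex.I * z * lam₁ / 2) * a x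
          + lam₂ * w * (τ⁻¹ * b (x + -dualShift Φ)) := by
      linear_combination -e2 + z * lam₁ / 2 * (w ^ 2 - 1) * a x * hI
    refine ⟨mul_left_cancel₀ hw ?_, e3⟩
    linear_combination
      z * (lam₁ / 2 * w ^ 2 + Complex.I * coCoupling lam₁ * w + lam₁ / 2) * e1
        - (Complex.I * q * w + z * lam₁ / 2 * (w ^ 2 - 1)) * e3 + z ^ 2 * w ^ 2 * a x * hsq1
        + (w * z * lam₂ * lam₁ * τ⁻¹ * b (x + -dualShift Φ) / 2 * (1 - w ^ 2)
          - w * z * lam₁ * Complex.I * a x * q / 2 * (1 - w ^ 2)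
          - w ^ 2 * z ^ 2 * lam₁ ^ 2 * a x / 2 - w ^ 2 * z ^ 2 * coCoupling lam₁ ^ 2 * a x
          - w ^ 2 * a x * q ^ 2 + w ^ 4 * z ^ 2 * lam₁ ^ 2 * a x / 4
          + z ^ 2 * lam₁ ^ 2 * a x / 4) * hI
  have hlc : (lam₁ : ℂ) ≠ 0 := by exact_mod_cast hl1.ne'
  have hg0 : dualMultiplier lam₁ ≠ 0 := quadPoly_ne_zero (div_ne_zero hlc two_ne_zero) _ _
  have hsq2 := coCoupling_sq hlam₂ hl2
  have hq0 := coCoupling_nonneg lam₂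
  have hc0 := coCoupling_nonneg lam₁
  have hr1 := real_coCoupling_sq hl1.le hlam₁
  have hr2 := real_coCoupling_sq hlam₂ hl2
  have hcq : coCoupling lam₁ ≤ coCoupling lam₂ := Real.sqrt_le_sqrt (by nlinarith)
  have hq1 : (1 + q) ≠ 0 := by
    have : (0 : ℝ) < 1 + coCoupling lam₂ := by linarith
    rw [hq]
    exact_mod_cast this.ne'
  -- For `λ₂ = 0` the multiplier vanishes and no cocycle exists, but the equations then kill `a` and
  -- `b` directly.
  rcases hlam₂.eq_or_lt with h2 | h2
  · subst h2
    have hA0 : A ≠ 0 := by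
      have hq2 : q ≠ 0 := by
        intro h
        rw [← hq, h] at hsq2
        norm_num at hsq2
      exact quadPoly_ne_zero (neg_ne_zero.mpr (mul_ne_zero (mul_ne_zero
        (mul_ne_zero Complex.I_ne_zero hq2) hlc) hz0)) _ _
    have ha0 : a =ᵐ[circMeasure] 0 := by
      filter_upwards [hcell, ae_eval_circChar_ne_zero hA0] with x ⟨e, _⟩ hx
      simp only [Complex.ofReal_zero, mul_zero, zero_mul, sub_zero] at e
      exact (mul_eq_zero.mp e.symm).resolve_left hx
    refine hnot ⟨ha0, ?_⟩
    filter_upwards [hcell, ha0, ae_eval_circChar_ne_zero hg0] with x ⟨_, e⟩ hax hx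
    simp only [hax, Complex.ofReal_zero, zero_mul, add_zero, Pi.zero_apply, mul_zero] at e
    exact (mul_eq_zero.mp e).resolve_left (mul_ne_zero hz0 hx)
  · have hl2c : (lam₂ : ℂ) ≠ 0 := by exact_mod_cast h2.ne'
    have hCz : Polynomial.C (z * lam₂) ≠ 0 := by simp [hz0, hl2c]
    have hmp : MeasurePreserving (fun x : Circ => x + -dualShift Φ) circMeasure circMeasure :=
      measurePreserving_add_right _ _
    have hmp' : MeasurePreserving (fun x : Circ => x + dualShift Φ) circMeasure circMeasure :=
      measurePreserving_add_right _ _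
    -- The second row is scaled by `λ₂` so that both rows share the multiplier `G`. The leading
    -- matrix has eigenvalues `-(i z λ₁ / 2)(1 + λ₂')` and `(i z λ₁ / 2)(1 - λ₂')`; `ρ` is the one
    -- of larger modulus.
    have hle := log_norm_eigenvalue_le_logMahlerMeasure (A := A)
      (B := .C (-(Complex.I * lam₂)) * h) (A' := .C (Complex.I * lam₂) * h)
      (B' := .C ((lam₂ : ℂ) ^ 2) * .X) (G := .C (z * lam₂) * dualMultiplier lam₁)
      (ρ := -(Complex.I * z * lam₁ * (1 + q) / 2)) (r₁ := 1 + q) (r₂ := Complex.I * lam₂)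
      (α := dualShift Φ) (τ := τ) (v := fun x => (a x, τ⁻¹ * b (x + -dualShift Φ)))
      (natDegree_quadPoly_le _ _ _)
      ((Polynomial.natDegree_C_mul_le _ _).trans (natDegree_quadPoly_le _ _ _))
      ((Polynomial.natDegree_C_mul_le _ _).trans (natDegree_quadPoly_le _ _ _))
      ((Polynomial.natDegree_C_mul_le _ _).trans (by simp)) (mul_ne_zero hCz hg0)
      (neg_ne_zero.mpr (div_ne_zero (mul_ne_zero (mul_ne_zero (mul_ne_zero Complex.I_ne_zero hz0)
        hlc) hq1) two_ne_zero)) hq1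
      (by
        rw [Polynomial.coeff_C_mul, hA, hh, coeff_two_quadPoly, coeff_two_quadPoly]
        linear_combination (-(Complex.I * z * lam₁ / 2)) * hsq2
          + Complex.I * lam₂ ^ 2 * z * lam₁ / 2 * hI)
      (by
        rw [Polynomial.coeff_C_mul, Polynomial.coeff_C_mul, hh, coeff_two_quadPoly,
          Polynomial.coeff_X_of_ne_one (by norm_num)]
        ring)
      (ergodic_circle_rotation hΦ) hτn
      (ha.1.aestronglyMeasurable.prodMk
        ((hb.1.comp_measurePreserving hmp).aestronglyMeasurable.const_mul _))
      (fun x => by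
        have hw := norm_circChar x
        have hconj := norm_quadratic_conj hw (lam₁ / 2) (coCoupling lam₁)
        push_cast at hconj
        rw [hA, hh, dualMultiplier]
        simp only [Polynomial.eval_mul, Polynomial.eval_C, Polynomial.eval_X, eval_quadPoly]
        generalize circChar x = w at *
        have e : (-(Complex.I * q * lam₁ * z) * w ^ 2 + (z ^ 2 + q ^ 2) * w
              + Complex.I * q * lam₁ * z) * ((lam₂ : ℂ) ^ 2 * w)
            - -(Complex.I * lam₂) * (-(Complex.I * z * lam₁ / 2) * w ^ 2 + q * w
              + Complex.I * z * lam₁ / 2) * (Complex.I * lam₂ *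
              (-(Complex.I * z * lam₁ / 2) * w ^ 2 + q * w + Complex.I * z * lam₁ / 2))
            = (z * lam₂) ^ 2 * ((lam₁ / 2 * w ^ 2 - Complex.I * coCoupling lam₁ * w + lam₁ / 2)
              * (lam₁ / 2 * w ^ 2 + Complex.I * coCoupling lam₁ * w + lam₁ / 2)) := by
          linear_combination (-(z * lam₂ * w) ^ 2) * hsq1 + lam₂ ^ 2 * (q ^ 2 * w ^ 2
            - Complex.I * q * lam₁ * z * w * (w ^ 2 - 1) + z ^ 2 * coCoupling lam₁ ^ 2 * w ^ 2
            + z ^ 2 * lam₁ ^ 2 / 4 * (Complex.I ^ 2 - 1) * (w ^ 2 - 1) ^ 2) * hI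
        rw [e, norm_mul, norm_mul, hconj, norm_mul, norm_pow]
        ring)
      (by
        filter_upwards [hcell] with x ⟨e1, e2⟩
        simp only [linMapOfEntries, LinearMap.coe_mk, AddHom.coe_mk, Polynomial.eval_mul,
          Polynomial.eval_C, Polynomial.eval_X, Prod.smul_mk, smul_eq_mul, add_neg_cancel_right]
        refine Prod.ext ?_ ?_
        · dsimp only
          linear_combination e1
        · dsimp only
          linear_combination (lam₂ : ℂ) * e2 + z * lam₂ * (dualMultiplier lam₁).eval (circChar x)
            * b x * mul_inv_cancel₀ hτ0)
      (fun hv => by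
        refine hnot ⟨?_, ?_⟩
        · filter_upwards [hv] with x hx
          exact congrArg Prod.fst hx
        · filter_upwards [hmp'.quasiMeasurePreserving.ae hv] with x hx
          have hx2 : τ⁻¹ * b (x + dualShift Φ + -dualShift Φ) = 0 := congrArg Prod.snd hx
          rw [add_neg_cancel_right] at hx2
          exact (mul_eq_zero.mp hx2).resolve_left (inv_ne_zero hτ0))
    rw [Polynomial.logMahlerMeasure_eq_log_MahlerMeasure, Real.log_le_log_iff
      (norm_pos_iff.mpr (neg_ne_zero.mpr (div_ne_zero (mul_ne_zero (mul_ne_zero (mul_ne_zero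
        Complex.I_ne_zero hz0) hlc) hq1) two_ne_zero)))
      (Polynomial.mahlerMeasure_pos_of_ne_zero (mul_ne_zero hCz hg0)),
      Polynomial.mahlerMeasure_mul, Polynomial.mahlerMeasure_const,
      mahlerMeasure_dualMultiplier hl1 hlam₁] at hle
    have hq1n : ‖1 + q‖ = 1 + coCoupling lam₂ := by
      rw [hq, ← Complex.ofReal_one, ← Complex.ofReal_add, Complex.norm_real, Real.norm_eq_abs,
        abs_of_nonneg (by linarith)]
    simp only [norm_neg, norm_div, norm_mul, Complex.norm_I, one_mul, hq1n, Complex.norm_real,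
      Real.norm_eq_abs, abs_of_pos hl1, abs_of_pos h2, Complex.norm_ofNat] at hle
    have hzn : 0 < ‖z‖ := norm_pos_iff.mpr hz0
    -- The size of `z` cancels, so unitarity of the walk is not required.
    have hlt : lam₂ * (1 + coCoupling lam₁) < lam₁ * (1 + coCoupling lam₂) :=
      mul_lt_mul hlam (by linarith) (by linarith) hl1.le
    have := mul_lt_mul_of_pos_left hlt hzn
    linarith
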